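/- Let $C_0(\mathbb R\cup\{+\infty\})$ be the continuous complex functions on $(-\infty,+\infty]$ vanishing at $-\infty$, acting on $L^2(\mathbb R)$ by multiplication operators $M(f)$. Let $\lambda$ be the regular representation of $\mathbb R$ on $L^2(\mathbb R)$, $(\lambda_t\xi)(x)=\xi(x-t)$, and also its integrated form, a representation of the group C*-algebra $C^*(\mathbb R)$ given on $L^1(\mathbb R)\subset C^*(\mathbb R)$ by convolution, $\lambda(g)\xi=g*\xi$. (Thus $\lambda(C^*(\mathbb R))$ is the norm closure of $\lambda(L^1(\mathbb R))$.) The Wiener–Hopf algebra $\mathcal T_{\mathbb R}$ is the C*-algebra on $L^2(\mathbb R)$ generated by all products $M(f)\lambda(g)$ with $f\in C_0(\mathbb R\cup\{+\infty\})$ and $g\in C^*(\mathbb R)$. Let $u$ be an orientation-preserving smooth diffeomorphism of $\mathbb R$ with $\lim_{x\to+\infty}u'(x)=+\infty$. Let $U:L^2(\mathbb R)\to L^2(\mathbb R)$ be the corresponding Hilbert space isomorphism, $(U\xi)(x)=u'(x)^{1/2}\,\xi(u(x))$, and write $\mathrm{Ad}_U(T)=UTU^{-1}$. Then $\mathcal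 T_{\mathbb R}$ is not preserved by $\mathrm{Ad}_U$, that is, $\mathrm{Ad}_U(\mathcal T_{\mathbb R})\not\subseteq\mathcal T_{\mathbb R}$. Moreover, $$\mathcal T_{\mathbb R}\cap \mathrm{Ad}_U(\mathcal T_{\mathbb R})=\mathcal K(L^2(\mathbb R)),$$ the set of all compact operators on $L^2(\mathbb R)$. -/

import Mathlib

open MeasureTheory Filter Topology
open scoped ContDiff Manifold ZeroAtInfty

noncomputable section

namespace WienerHopf

/-- The Hilbert space `L²(ℝ)` of complex-valued functions, with Lebesgue measure. -/
abbrev L2R : Type := Lp ℂ 2 (volume : Measure ℝ)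

/-! ### The multiplication representation of `C₀(ℝ ∪ {+∞})` -/

/-- The one-sided extension `(-∞, +∞]` of the real line, with its order topology. -/
abbrev ExtLine : Type := Set.Ioi (⊥ : EReal)

/-- The inclusion of the real line into `(-∞, +∞]`. -/
def toExtLine (x : ℝ) : ExtLine := ⟨(x : EReal), EReal.bot_lt_coe x⟩

theorem continuous_toExtLine : Continuous toExtLine :=
  Continuous.subtype_mk continuous_coe_real_ereal _

theorem memLp_restrict (f : C₀(ExtLine, ℂ)) :
    MemLp (fun x : ℝ => f (toExtLine x)) ⊤ (volume : Measure ℝ) := by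
  refine memLp_top_of_bound
    ((map_continuous f).comp continuous_toExtLine).aestronglyMeasurable ‖f.toBCF‖ ?_
  exact Eventually.of_forall fun x => f.toBCF.norm_coe_le_norm (toExtLine x)

/-- `M(f)`: multiplication by (the restriction to `ℝ` of) `f ∈ C₀(ℝ ∪ {+∞})` on `L²(ℝ)`. -/
def mulRep (f : C₀(ExtLine, ℂ)) : L2R →L[ℂ] L2R :=
  (ContinuousLinearMap.mul ℂ ℂ).holderL volume ⊤ 2 2 (memLp_restrict f).toLp

theorem mulRep_coeFn (f : C₀(ExtLine, ℂ)) (ξ : L2R) :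
    mulRep f ξ =ᵐ[volume] fun x => f (toExtLine x) * ξ x := by
  have h1 := (ContinuousLinearMap.mul ℂ ℂ).coeFn_holder (r := 2) (memLp_restrict f).toLp ξ
  have h2 := (memLp_restrict f).coeFn_toLp
  filter_upwards [h1, h2] with x hx1 hx2
  rw [mulRep, ContinuousLinearMap.holderL_apply_apply, hx1, hx2]
  rfl

/-! ### The regular representation of `ℝ` and its integrated form -/

/-- The regular representation of the group `ℝ` on `L²(ℝ)`: `(λ_t ξ)(x) = ξ(x - t)`. -/
def translation (t : ℝ) : L2R →ₗᵢ[ℂ] L2R :=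
  Lp.compMeasurePreservingₗᵢ ℂ (fun x : ℝ => x - t) (measurePreserving_sub_right volume t)

theorem translation_coeFn (t : ℝ) (ξ : L2R) :
    translation t ξ =ᵐ[volume] fun x => ξ (x - t) :=
  Lp.coeFn_compMeasurePreserving ξ (measurePreserving_sub_right volume t)

theorem continuous_translation (ξ : L2R) : Continuous fun t : ℝ => translation t ξ := by
  let g : ℝ → C(ℝ, ℝ) := fun t => ⟨fun x => x - t, by fun_prop⟩
  have hg : Continuous g := by
    refine ContinuousMap.continuous_of_continuous_uncurry _ ?_
    change Continuous fun p : ℝ × ℝ => p.2 - p.1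
    fun_prop
  exact (continuous_const (y := ξ)).compMeasurePreservingLp hg
    (fun t => measurePreserving_sub_right volume t) (by simp)

theorem integrable_smul_translation (g : Lp ℂ 1 (volume : Measure ℝ)) (ξ : L2R) :
    Integrable (fun t : ℝ => g t • translation t ξ) volume := by
  refine ((L1.integrable_coeFn g).norm.mul_const ‖ξ‖).mono'
    ((Lp.aestronglyMeasurable g).smul (continuous_translation ξ).aestronglyMeasurable) ?_
  refine Eventually.of_forall fun t => ?_
  simp [norm_smul]

/-- The integrated form of the regular representation on `L¹(ℝ)`, that is, convolution:
`λ(g) ξ = g * ξ = ∫ g(t) λ_t ξ dt`, an absolutely convergent integral in `L²(ℝ)`. -/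
def convRep (g : Lp ℂ 1 (volume : Measure ℝ)) : L2R →L[ℂ] L2R :=
  LinearMap.mkContinuous
    { toFun := fun ξ => ∫ t : ℝ, g t • translation t ξ
      map_add' := fun ξ η => by
        rw [← integral_add (integrable_smul_translation g ξ) (integrable_smul_translation g η)]
        simp only [map_add, smul_add]
      map_smul' := fun c ξ => by
        rw [RingHom.id_apply, ← integral_smul]
        simp only [map_smul, smul_comm c] }
    ‖g‖ (fun ξ => by
      refine (norm_integral_le_integral_norm _).trans (le_of_eq ?_)
      simp only [norm_smul, LinearIsometry.norm_map, integral_mul_const, L1.norm_eq_integral_norm])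

/-- `λ(C*(ℝ))`: the concrete group C⋆-algebra of `ℝ`, the norm closure in `B(L²(ℝ))` of the
algebra of convolution operators by integrable functions. -/
def groupCStar : NonUnitalStarSubalgebra ℂ (L2R →L[ℂ] L2R) :=
  (NonUnitalStarAlgebra.adjoin ℂ (Set.range convRep)).topologicalClosure

/-- The Wiener–Hopf algebra `T_ℝ`: the C⋆-subalgebra of `B(L²(ℝ))` generated by the products
`M(f) λ(g)` with `f ∈ C₀(ℝ ∪ {+∞})` and `g ∈ C*(ℝ)`. -/
def wienerHopf : NonUnitalStarSubalgebra ℂ (L2R →L[ℂ] L2R) :=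
  (NonUnitalStarAlgebra.adjoin ℂ
    {T | ∃ f : C₀(ExtLine, ℂ), ∃ G ∈ groupCStar, T = mulRep f * G}).topologicalClosure

/-! ### The unitary induced by an orientation-preserving diffeomorphism -/

/-- Smooth diffeomorphisms of the real line. -/
abbrev DiffeoR : Type := Diffeomorph 𝓘(ℝ, ℝ) 𝓘(ℝ, ℝ) ℝ ℝ ∞

/-- `u` preserves the orientation of `ℝ`. -/
def OrientationPreserving (u : DiffeoR) : Prop := ∀ x : ℝ, 0 < deriv u x

theorem hasDerivAt (u : DiffeoR) (x : ℝ) : HasDerivAt u (deriv u x) x :=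
  ((u.contMDiff.contDiff.differentiable (by simp)) x).hasDerivAt

theorem deriv_mul_deriv_symm (u : DiffeoR) (x : ℝ) : deriv u x * deriv u.symm (u x) = 1 := by
  have h := (hasDerivAt u.symm (u x)).comp x (hasDerivAt u x)
  have h2 : (⇑u.symm ∘ ⇑u) = id := funext fun y => u.symm_apply_apply y
  rw [h2] at h
  rw [mul_comm]
  exact h.unique (hasDerivAt_id x)

theorem OrientationPreserving.symm {u : DiffeoR} (hu : OrientationPreserving u) :
    OrientationPreserving u.symm := fun y => by
  have h := deriv_mul_deriv_symm u (u.symm y)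
  rw [u.apply_symm_apply] at h
  have := hu (u.symm y)
  by_contra hc
  nlinarith [not_lt.mp hc]

theorem lintegral_comp_diffeo {u : DiffeoR} (hu : OrientationPreserving u) (g : ℝ → ENNReal) :
    ∫⁻ x, ENNReal.ofReal (deriv u x) * g (u x) = ∫⁻ y, g y := by
  have hs : Function.Surjective (⇑u) := u.surjective
  have h := lintegral_image_eq_lintegral_abs_deriv_mul (f := u) (f' := deriv u) MeasurableSet.univ
    (fun x _ => (hasDerivAt u x).hasDerivWithinAt) u.injective.injOn g
  rw [Set.image_univ, hs.range_eq] at h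
  simp only [Measure.restrict_univ] at h
  rw [h]
  simp only [abs_of_pos (hu _)]

theorem quasiMeasurePreserving {u : DiffeoR} (hu : OrientationPreserving u) :
    Measure.QuasiMeasurePreserving u (volume : Measure ℝ) volume := by
  refine ⟨u.continuous.measurable, Measure.AbsolutelyContinuous.mk fun s hs h0 => ?_⟩
  rw [Measure.map_apply u.continuous.measurable hs]
  have h1 := lintegral_comp_diffeo hu (s.indicator 1)
  rw [lintegral_indicator_one hs, h0, lintegral_eq_zero_iff] at h1
  · refine measure_mono_null (fun x hx => ?_) (ae_iff.mp h1)
    have hx' : u x ∈ s := hx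
    simp [hx', hu x]
  · exact ((measurable_deriv _).ennreal_ofReal).mul
      ((measurable_one.indicator hs).comp u.continuous.measurable)

theorem eLpNorm_weighted {u : DiffeoR} (hu : OrientationPreserving u) (ξ : ℝ → ℂ) :
    eLpNorm (fun x => ((Real.sqrt (deriv u x) : ℝ) : ℂ) * ξ (u x)) 2 (volume : Measure ℝ) =
      eLpNorm ξ 2 volume := by
  rw [eLpNorm_eq_lintegral_rpow_enorm_toReal (by norm_num) (by norm_num),
    eLpNorm_eq_lintegral_rpow_enorm_toReal (by norm_num) (by norm_num)]
  congr 1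
  rw [← lintegral_comp_diffeo hu (fun y => ‖ξ y‖ₑ ^ (2 : ENNReal).toReal)]
  refine lintegral_congr fun x => ?_
  rw [enorm_mul, ENNReal.mul_rpow_of_nonneg _ _ (by norm_num)]
  congr 1
  rw [← ofReal_norm, Complex.norm_real, Real.norm_of_nonneg (Real.sqrt_nonneg _),
    ENNReal.ofReal_rpow_of_nonneg (Real.sqrt_nonneg _) (by norm_num)]
  simp [Real.sq_sqrt (hu x).le]

theorem memLp_weighted {u : DiffeoR} (hu : OrientationPreserving u) (ξ : L2R) :
    MemLp (fun x => ((Real.sqrt (deriv u x) : ℝ) : ℂ) * ξ (u x)) 2 (volume : Measure ℝ) := by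
  refine ⟨?_, ?_⟩
  · refine AEStronglyMeasurable.mul ?_
      ((Lp.aestronglyMeasurable ξ).comp_quasiMeasurePreserving (quasiMeasurePreserving hu))
    exact (Complex.measurable_ofReal.comp
      (Real.continuous_sqrt.measurable.comp (measurable_deriv _))).aestronglyMeasurable
  · rw [eLpNorm_weighted hu]
    exact Lp.eLpNorm_lt_top ξ

/-- `ξ ↦ (u')^{1/2} · (ξ ∘ u)` on `L²(ℝ)`. -/
def pullback {u : DiffeoR} (hu : OrientationPreserving u) (ξ : L2R) : L2R :=
  (memLp_weighted hu ξ).toLp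

theorem pullback_coeFn {u : DiffeoR} (hu : OrientationPreserving u) (ξ : L2R) :
    pullback hu ξ =ᵐ[volume] fun x => ((Real.sqrt (deriv u x) : ℝ) : ℂ) * ξ (u x) :=
  (memLp_weighted hu ξ).coeFn_toLp

theorem pullback_symm_pullback {u v : DiffeoR} (hu : OrientationPreserving u)
    (hv : OrientationPreserving v) (huv : ∀ x, v (u x) = x)
    (hd : ∀ x, deriv u x * deriv v (u x) = 1) (ξ : L2R) :
    pullback hu (pullback hv ξ) = ξ := by
  refine Lp.ext ?_
  filter_upwards [pullback_coeFn hu (pullback hv ξ),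
    (quasiMeasurePreserving hu).ae (pullback_coeFn hv ξ)] with x h1 h2
  rw [h1, h2, huv, ← mul_assoc, ← Complex.ofReal_mul, ← Real.sqrt_mul (hu x).le, hd]
  simp

/-- The unitary operator `U` of `L²(ℝ)` induced by an orientation-preserving diffeomorphism `u`:
`(U ξ)(x) = u'(x)^{1/2} ξ(u(x))`. -/
def diffeoUnitary (u : DiffeoR) (hu : OrientationPreserving u) : L2R ≃ₗᵢ[ℂ] L2R where
  toFun := pullback hu
  invFun := pullback hu.symm
  map_add' ξ η := by
    refine Lp.ext ?_
    filter_upwards [pullback_coeFn hu (ξ + η), Lp.coeFn_add (pullback hu ξ) (pullback hu η),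
      pullback_coeFn hu ξ, pullback_coeFn hu η,
      (quasiMeasurePreserving hu).ae (Lp.coeFn_add ξ η)] with x h1 h2 h3 h4 h5
    rw [h1, h2, Pi.add_apply, h3, h4, h5, Pi.add_apply, mul_add]
  map_smul' c ξ := by
    refine Lp.ext ?_
    filter_upwards [pullback_coeFn hu (c • ξ), Lp.coeFn_smul c (pullback hu ξ),
      pullback_coeFn hu ξ, (quasiMeasurePreserving hu).ae (Lp.coeFn_smul c ξ)] with x h1 h2 h3 h4
    rw [RingHom.id_apply, h1, h2, Pi.smul_apply, h3, h4, Pi.smul_apply, smul_eq_mul, smul_eq_mul,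
      mul_left_comm]
  left_inv ξ := by
    refine pullback_symm_pullback hu.symm hu u.apply_symm_apply (fun y => ?_) ξ
    have h := deriv_mul_deriv_symm u (u.symm y)
    rwa [u.apply_symm_apply, mul_comm] at h
  right_inv ξ :=
    pullback_symm_pullback hu hu.symm u.symm_apply_apply (deriv_mul_deriv_symm u) ξ
  norm_map' ξ := by
    change ‖(memLp_weighted hu ξ).toLp‖ = ‖ξ‖
    rw [Lp.norm_toLp, eLpNorm_weighted hu, Lp.norm_def]

theorem diffeoUnitary_coeFn (u : DiffeoR) (hu : OrientationPreserving u) (ξ : L2R) :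
    diffeoUnitary u hu ξ =ᵐ[volume] fun x => ((Real.sqrt (deriv u x) : ℝ) : ℂ) * ξ (u x) :=
  pullback_coeFn hu ξ

/-- `Ad_U(A) = U A U⁻¹` for a `⋆`-subalgebra `A` of `B(L²(ℝ))` and a unitary operator `U`. -/
def adImage (U : L2R ≃ₗᵢ[ℂ] L2R) (A : NonUnitalStarSubalgebra ℂ (L2R →L[ℂ] L2R)) :
    NonUnitalStarSubalgebra ℂ (L2R →L[ℂ] L2R) :=
  A.map U.conjStarAlgEquiv

end WienerHopf

end

/-!
Modulo compact operators, `M(f) λ(g)` depends only on `f(+∞)` and `λ(g)`, so every `T` in the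
Wiener–Hopf algebra has the form `M(χ) G + compact`, where `χ` rises from `0` to `1` and the symbol
`G ∈ λ(C*(ℝ))` is recovered from `T` as the strong limit of its translates at `+∞`. Since `u' → ∞`,
the function `ψ = e ∘ u⁻¹` varies slowly at `+∞` for every character `e` of `ℝ`, hence `M(ψ)`
commutes with the Wiener–Hopf algebra modulo compacts. Conjugating by `U` turns `M(ψ)` into `M(e)`,
so the symbol `G` of an element of the intersection commutes with every `M(e)`. But conjugation by
`M(e)` translates the Fourier transform of `G`, which vanishes at infinity, so `G = 0`.

The commutators and cutoffs are shown to be compact through the operators `M(φ) λ(g) M(θ)` with `φ`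
and `θ` compactly supported. Such an operator has rank one if `g = 1` on the differences of the two
supports, multiplying `g` by a character only multiplies it by unitaries on both sides, and every
continuous `g` agrees on these differences with a uniform limit of trigonometric polynomials.
-/

noncomputable section

namespace WienerHopf

open scoped BoundedContinuousFunction ComplexConjugate ENNReal

section CompactOperator

open InnerProductSpace ContinuousLinearMap

variable {𝕜 E F : Type*} [RCLike 𝕜] [NormedAddCommGroup E] [InnerProductSpace 𝕜 E]
  [NormedAddCommGroup F] [InnerProductSpace 𝕜 F]

theorem isCompactOperator_rankOne (x : F) (y : E) : IsCompactOperator (rankOne 𝕜 x y) := by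
  rw [rankOne_def']
  exact (isCompactOperator_of_locallyCompactSpace_rng
    (ContinuousLinearMap.toSpanSingleton 𝕜 x)).comp_clm _

theorem exists_norm_starProjection_comp_sub_lt {T : E →L[𝕜] F} (hT : IsCompactOperator T) {ε : ℝ}
    (hε : 0 < ε) :
    ∃ (S : Submodule 𝕜 F) (_ : FiniteDimensional 𝕜 S), ‖T - S.starProjection ∘L T‖ < ε := by
  obtain ⟨t, ht, hcover⟩ := Metric.totallyBounded_iff.mp
    (hT.isCompact_closure_image_closedBall (f := T.toLinearMap) 1).totallyBounded (ε / 2)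
    (half_pos hε)
  have : FiniteDimensional 𝕜 (Submodule.span 𝕜 t) := FiniteDimensional.span_of_finite 𝕜 ht
  refine ⟨Submodule.span 𝕜 t, this, lt_of_le_of_lt ?_ (half_lt_self hε)⟩
  refine ContinuousLinearMap.opNorm_le_of_unit_norm (half_pos hε).le fun x hx => ?_
  have hTx : T x ∈ closure (T '' Metric.closedBall 0 1) := subset_closure ⟨x, by simp [hx], rfl⟩
  obtain ⟨y, hy, hxy⟩ := Set.mem_iUnion₂.mp (hcover hTx)
  rw [sub_apply, ContinuousLinearMap.comp_apply, Submodule.starProjection_minimal]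
  refine (ciInf_le ⟨0, ?_⟩ (⟨y, Submodule.subset_span hy⟩ : Submodule.span 𝕜 t)).trans ?_
  · rintro _ ⟨z, rfl⟩
    exact norm_nonneg _
  · rw [← dist_eq_norm]
    exact (Metric.mem_ball.mp hxy).le

variable [CompleteSpace E] [CompleteSpace F]

theorem compactOperator_induction {p : (E →L[𝕜] F) → Prop}
    (rankOne : ∀ x y, p (rankOne 𝕜 x y)) (add : ∀ S T, p S → p T → p (S + T))
    (isClosed : IsClosed {T | p T}) {T : E →L[𝕜] F} (hT : IsCompactOperator T) : p T := by
  refine closure_minimal subset_rfl isClosed (Metric.mem_closure_iff.mpr fun ε hε => ?_)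
  obtain ⟨S, _, hS⟩ := exists_norm_starProjection_comp_sub_lt hT hε
  refine ⟨S.starProjection ∘L T, ?_, by rwa [dist_eq_norm]⟩
  rw [(stdOrthonormalBasis 𝕜 S).starProjection_eq_sum_rankOne, finsetSum_comp]
  refine Finset.sum_induction _ p add ?_ fun i _ => ?_
  · simpa only [map_zero] using rankOne 0 0
  · rw [rankOne_comp]
    exact rankOne _ _

theorem isCompactOperator_adjoint {T : E →L[𝕜] F} (hT : IsCompactOperator T) :
    IsCompactOperator (adjoint T) := by
  refine compactOperator_induction (p := fun T => IsCompactOperator (adjoint T))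
    (fun x y => ?_) (fun S T hS hT => ?_) ?_ hT
  · rw [adjoint_rankOne]
    exact isCompactOperator_rankOne y x
  · rw [map_add]
    exact hS.add hT
  · exact (isClosed_setOfPred_isCompactOperator (M₁ := F) (M₂ := E)).preimage
      (adjoint (𝕜 := 𝕜) (E := E) (F := F)).continuous

theorem tendsto_zero_of_isCompactOperator {T : E →L[𝕜] F} (hT : IsCompactOperator T)
    {ι : Type*} {l : Filter ι} {v : ι → E} {C : NNReal} (hv : ∀ i, ‖v i‖₊ ≤ C)
    (hweak : ∀ y, Tendsto (fun i => inner 𝕜 y (v i)) l (𝓝 0)) :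
    Tendsto (fun i => T (v i)) l (𝓝 0) := by
  refine compactOperator_induction (p := fun T => Tendsto (fun i => T (v i)) l (𝓝 0))
    (fun x y => ?_) (fun S T hS hT => ?_) ?_ hT
  · simpa only [rankOne_apply, zero_smul] using (hweak y).smul_const x
  · simpa only [add_apply, add_zero] using hS.add hT
  · refine (LipschitzWith.uniformEquicontinuous (fun i (T : E →L[𝕜] F) => T (v i)) C fun i =>
      LipschitzWith.of_dist_le_mul fun S T => ?_).equicontinuous.isClosed_setOfPred_tendsto
      continuous_const
    rw [dist_eq_norm, dist_eq_norm, ← sub_apply, mul_comm]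
    exact ((S - T).le_opNorm _).trans (by gcongr; exact hv i)

theorem isCompactOperator_conjStarAlgEquiv_iff {e : E ≃ₗᵢ[𝕜] F} {T : E →L[𝕜] E} :
    IsCompactOperator (e.conjStarAlgEquiv T) ↔ IsCompactOperator T := by
  refine ⟨fun h => ?_, fun h => (h.clm_comp (e : E →L[𝕜] F)).comp_clm (e.symm : F →L[𝕜] E)⟩
  rw [← e.conjStarAlgEquiv.symm_apply_apply T]
  exact (h.clm_comp (e.symm : F →L[𝕜] E)).comp_clm (e : E →L[𝕜] F)

end CompactOperator

theorem coeFn_mul_holderL {p : ℝ≥0∞} [Fact (1 ≤ p)] (f : ℝ →ᵇ ℂ)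
    (ξ : Lp ℂ p (volume : Measure ℝ)) :
    (ContinuousLinearMap.mul ℂ ℂ).holderL volume ⊤ p p (f.memLp_top.toLp f) ξ
      =ᵐ[volume] fun x => f x * ξ x := by
  filter_upwards [(ContinuousLinearMap.mul ℂ ℂ).coeFn_holder (r := p) (f.memLp_top.toLp f) ξ,
    f.memLp_top.coeFn_toLp (μ := volume)] with x hmul hf
  rw [ContinuousLinearMap.holderL_apply_apply, hmul, hf, ContinuousLinearMap.mul_apply']

/-- The representation of bounded continuous functions on `L²(ℝ)` by multiplication operators; it
extends `mulRep` from `C₀(ℝ ∪ {+∞})` to a unital algebra containing the characters of `ℝ`. -/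
def mulOp : (ℝ →ᵇ ℂ) →⋆ₐ[ℂ] (L2R →L[ℂ] L2R) where
  toFun f := (ContinuousLinearMap.mul ℂ ℂ).holderL volume ⊤ 2 2 (f.memLp_top.toLp f)
  map_one' := by
    ext1 ξ
    refine Lp.ext ?_
    filter_upwards [coeFn_mul_holderL 1 ξ] with x h
    rw [h, BoundedContinuousFunction.coe_one, Pi.one_apply, one_mul, one_apply_eq_self]
  map_mul' f g := by
    ext1 ξ
    refine Lp.ext ?_
    rw [mul_apply_eq_comp]
    filter_upwards [coeFn_mul_holderL (f * g) ξ, coeFn_mul_holderL g ξ,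
      coeFn_mul_holderL f ((ContinuousLinearMap.mul ℂ ℂ).holderL volume ⊤ 2 2
        (g.memLp_top.toLp g) ξ)] with x hfg hg hf
    rw [hfg, hf, hg, BoundedContinuousFunction.mul_apply, mul_assoc]
  map_zero' := map_zero _
  map_add' f g := map_add ((ContinuousLinearMap.mul ℂ ℂ).holderL volume ⊤ 2 2)
    (f.memLp_top.toLp f) (g.memLp_top.toLp g)
  commutes' c := by
    ext1 ξ
    refine Lp.ext ?_
    filter_upwards [coeFn_mul_holderL (algebraMap ℂ (ℝ →ᵇ ℂ) c) ξ, Lp.coeFn_smul c ξ] with x h h'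
    rw [h, BoundedContinuousFunction.algebraMap_apply, Algebra.algebraMap_eq_smul_one, smul_apply,
      one_apply_eq_self, h', Pi.smul_apply, smul_eq_mul, smul_eq_mul, mul_one]
  map_star' f := by
    rw [ContinuousLinearMap.star_eq_adjoint, ContinuousLinearMap.eq_adjoint_iff]
    intro ξ η
    rw [L2.inner_def, L2.inner_def]
    refine integral_congr_ae ?_
    filter_upwards [coeFn_mul_holderL f η, coeFn_mul_holderL (star f) ξ] with x h h'
    rw [h, h', RCLike.inner_apply, RCLike.inner_apply, map_mul,
      BoundedContinuousFunction.star_apply, RCLike.star_def, Complex.conj_conj, mul_assoc,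
      mul_left_comm]

theorem mulOp_coeFn (f : ℝ →ᵇ ℂ) (ξ : L2R) : mulOp f ξ =ᵐ[volume] fun x => f x * ξ x :=
  coeFn_mul_holderL f ξ

theorem mulRep_eq_mulOp (f : C₀(ExtLine, ℂ)) :
    mulRep f = mulOp (f.toBCF.compContinuous ⟨toExtLine, continuous_toExtLine⟩) :=
  rfl

theorem norm_mulOp_le (f : ℝ →ᵇ ℂ) : ‖mulOp f‖ ≤ ‖f‖ :=
  NonUnitalStarAlgHom.norm_apply_le mulOp f

theorem continuous_mulOp : Continuous mulOp :=
  AddMonoidHomClass.continuous_of_bound mulOp 1 fun f => by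
    rw [one_mul]
    exact norm_mulOp_le f

theorem inner_mulOp (f : ℝ →ᵇ ℂ) (η ξ : L2R) :
    inner ℂ η (mulOp f ξ) = ∫ x, f x * inner ℂ (η x) (ξ x) := by
  rw [L2.inner_def]
  refine integral_congr_ae ?_
  filter_upwards [mulOp_coeFn f ξ] with x h
  rw [h, ← smul_eq_mul, inner_smul_right]

theorem norm_mulOp_apply_sq (f : ℝ →ᵇ ℂ) (ξ : L2R) :
    ‖mulOp f ξ‖ ^ 2 = ∫ x, ‖f x‖ ^ 2 * ‖ξ x‖ ^ 2 := by
  rw [← RCLike.ofReal_inj (K := ℂ), RCLike.ofReal_pow, ← inner_self_eq_norm_sq_to_K, L2.inner_def,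
    ← integral_ofReal]
  refine integral_congr_ae ?_
  filter_upwards [mulOp_coeFn f ξ] with x h
  rw [h, inner_self_eq_norm_sq_to_K, norm_mul]
  push_cast
  ring

theorem tendsto_mulOp_apply {ι : Type*} {l : Filter ι} [l.IsCountablyGenerated] {f : ι → ℝ →ᵇ ℂ}
    {g : ℝ →ᵇ ℂ} {C : ℝ} (hC : ∀ i, ‖f i‖ ≤ C) (hfg : ∀ x, Tendsto (fun i => f i x) l (𝓝 (g x)))
    (ξ : L2R) : Tendsto (fun i => mulOp (f i) ξ) l (𝓝 (mulOp g ξ)) := by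
  rw [tendsto_iff_norm_sub_tendsto_zero]
  suffices Tendsto (fun i => ‖mulOp (f i - g) ξ‖ ^ 2) l (𝓝 0) by
    simpa only [map_sub, sub_apply, Real.sqrt_sq (norm_nonneg _), Real.sqrt_zero] using this.sqrt
  simp only [norm_mulOp_apply_sq]
  rw [← integral_zero ℝ ℝ]
  refine tendsto_integral_filter_of_dominated_convergence
    (fun x => (C + ‖g‖) ^ 2 * ‖ξ x‖ ^ 2) ?_ ?_ ?_ ?_
  · exact .of_forall fun i =>
      ((f i - g).continuous.norm.pow 2).aestronglyMeasurable.mul ((Lp.memLp ξ).1.norm.pow 2)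
  · refine .of_forall fun i => .of_forall fun x => ?_
    rw [Real.norm_of_nonneg (by positivity)]
    gcongr
    exact ((f i - g).norm_coe_le_norm x).trans ((norm_sub_le _ _).trans (by gcongr; exact hC i))
  · exact (Lp.memLp ξ).norm.integrable_sq.const_mul _
  · refine .of_forall fun x => ?_
    have := ((tendsto_iff_norm_sub_tendsto_zero.mp (hfg x)).pow 2).mul_const (‖ξ x‖ ^ 2)
    simpa using this

/-- The operator `λ_t` on `L²(ℝ)`; this is `translation t` as an element of the algebra of bounded
operators. -/
def translationL (t : ℝ) : L2R →L[ℂ] L2R := (translation t).toContinuousLinearMap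

theorem translationL_coeFn (t : ℝ) (ξ : L2R) : translationL t ξ =ᵐ[volume] fun x => ξ (x - t) :=
  translation_coeFn t ξ

theorem norm_translationL_apply (t : ℝ) (ξ : L2R) : ‖translationL t ξ‖ = ‖ξ‖ :=
  (translation t).norm_map ξ

theorem ae_comp_sub {p : ℝ → Prop} (h : ∀ᵐ x, p x) (t : ℝ) : ∀ᵐ x : ℝ, p (x - t) :=
  (measurePreserving_sub_right volume t).quasiMeasurePreserving.ae h

theorem translationL_zero : translationL 0 = 1 := by
  ext1 ξ
  refine Lp.ext ?_
  filter_upwards [translationL_coeFn 0 ξ] with x h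
  rw [h, sub_zero, one_apply_eq_self]

theorem translationL_mul (s t : ℝ) : translationL s * translationL t = translationL (s + t) := by
  ext1 ξ
  refine Lp.ext ?_
  rw [mul_apply_eq_comp]
  filter_upwards [translationL_coeFn s (translationL t ξ), ae_comp_sub (translationL_coeFn t ξ) s,
    translationL_coeFn (s + t) ξ] with x hs ht hst
  rw [hs, ht, hst, sub_sub]

theorem translationL_neg_mul (t : ℝ) : translationL (-t) * translationL t = 1 := by
  rw [translationL_mul, neg_add_cancel, translationL_zero]

theorem star_translationL (t : ℝ) : star (translationL t) = translationL (-t) := by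
  have isometry : star (translationL t) * translationL t = 1 :=
    (translation t).adjoint_comp_self
  exact left_inv_eq_right_inv isometry (by rw [translationL_mul, add_neg_cancel, translationL_zero])

theorem mulOp_mul_translationL (f : ℝ →ᵇ ℂ) (t : ℝ) :
    mulOp f * translationL t = translationL t * mulOp (f.compContinuous (.addRight t)) := by
  ext1 ξ
  refine Lp.ext ?_
  rw [mul_apply_eq_comp, mul_apply_eq_comp]
  filter_upwards [mulOp_coeFn f (translationL t ξ), translationL_coeFn t ξ,
    translationL_coeFn t (mulOp (f.compContinuous (.addRight t)) ξ),
    ae_comp_sub (mulOp_coeFn (f.compContinuous (.addRight t)) ξ) t] with x hf ht hft htf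
  rw [hf, ht, hft, htf]
  simp only [BoundedContinuousFunction.compContinuous_apply, ContinuousMap.coe_addRight,
    sub_add_cancel]

theorem tendsto_mulOp_addRight {f : ℝ →ᵇ ℂ} {c : ℂ} (hf : Tendsto f atTop (𝓝 c)) (ξ : L2R) :
    Tendsto (fun t => mulOp (f.compContinuous (.addRight t)) ξ) atTop (𝓝 (c • ξ)) := by
  have hlim := tendsto_mulOp_apply (l := atTop) (g := algebraMap ℂ (ℝ →ᵇ ℂ) c)
    (fun t => f.norm_compContinuous_le (.addRight t))
    (fun x => ?_) ξ
  · rwa [AlgHomClass.commutes, Algebra.algebraMap_eq_smul_one, smul_apply, one_apply_eq_self]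
      at hlim
  · rw [BoundedContinuousFunction.algebraMap_apply, smul_eq_mul, mul_one]
    exact hf.comp (tendsto_atTop_add_const_left _ x tendsto_id)

theorem convRep_apply (g : Lp ℂ 1 (volume : Measure ℝ)) (ξ : L2R) :
    convRep g ξ = ∫ t : ℝ, g t • translationL t ξ :=
  rfl

theorem norm_convRep_le (g : Lp ℂ 1 (volume : Measure ℝ)) : ‖convRep g‖ ≤ ‖g‖ :=
  LinearMap.mkContinuous_norm_le _ (norm_nonneg _) _

theorem integrable_smul_translationL (g : Lp ℂ 1 (volume : Measure ℝ)) (ξ : L2R) :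
    Integrable fun t : ℝ => g t • translationL t ξ :=
  integrable_smul_translation g ξ

theorem mul_convRep_mul_apply (A B : L2R →L[ℂ] L2R) (g : Lp ℂ 1 (volume : Measure ℝ)) (ξ : L2R) :
    (A * convRep g * B) ξ = ∫ t : ℝ, g t • (A * translationL t * B) ξ := by
  simp only [mul_apply_eq_comp]
  rw [convRep_apply, ← A.integral_comp_comm (integrable_smul_translationL g (B ξ))]
  simp only [map_smul]

theorem inner_convRep (g : Lp ℂ 1 (volume : Measure ℝ)) (η ξ : L2R) :
    inner ℂ η (convRep g ξ) = ∫ t : ℝ, g t * inner ℂ η (translationL t ξ) := by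
  rw [convRep_apply, ← integral_inner (integrable_smul_translationL g ξ)]
  simp only [inner_smul_right]

/-- The integrated form of the regular representation as a bounded linear map on `L¹(ℝ)`. -/
def convRepL : Lp ℂ 1 (volume : Measure ℝ) →L[ℂ] (L2R →L[ℂ] L2R) :=
  LinearMap.mkContinuous
    { toFun := convRep
      map_add' := fun g h => by
        ext1 ξ
        rw [add_apply, convRep_apply, convRep_apply, convRep_apply,
          ← integral_add (integrable_smul_translationL g ξ) (integrable_smul_translationL h ξ)]
        refine integral_congr_ae ?_
        filter_upwards [Lp.coeFn_add g h] with t ht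
        rw [ht, Pi.add_apply, add_smul]
      map_smul' := fun c g => by
        ext1 ξ
        rw [smul_apply, convRep_apply, convRep_apply, RingHom.id_apply, ← integral_smul]
        refine integral_congr_ae ?_
        filter_upwards [Lp.coeFn_smul c g] with t ht
        rw [ht, Pi.smul_apply, smul_assoc] }
    1 fun g => (norm_convRep_le g).trans_eq (one_mul _).symm

theorem convRepL_apply (g : Lp ℂ 1 (volume : Measure ℝ)) : convRepL g = convRep g := rfl

theorem translationL_mul_convRep (s : ℝ) (g : Lp ℂ 1 (volume : Measure ℝ)) :
    translationL s * convRep g = convRep (DomAddAct.mk (-s) +ᵥ g) := by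
  ext1 ξ
  have h := mul_convRep_mul_apply (translationL s) 1 g ξ
  simp only [mul_one, translationL_mul] at h
  rw [h, convRep_apply, ← integral_sub_right_eq_self _ s]
  refine integral_congr_ae ?_
  filter_upwards [DomAddAct.vadd_Lp_ae_eq (DomAddAct.mk (-s)) g] with t ht
  rw [ht, add_sub_cancel, Equiv.symm_apply_apply, vadd_eq_add, neg_add_eq_sub]

theorem integrable_smul_vadd (g h : Lp ℂ 1 (volume : Measure ℝ)) :
    Integrable fun t : ℝ => g t • (DomAddAct.mk (-t) +ᵥ h) := by
  have : Fact ((1 : ℝ≥0∞) ≠ ⊤) := ⟨ENNReal.one_ne_top⟩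
  have continuous_vadd : Continuous fun t : ℝ => DomAddAct.mk (-t) +ᵥ h :=
    (DomAddAct.continuous_mk.comp continuous_neg).vadd continuous_const
  refine ((L1.integrable_coeFn g).norm.mul_const ‖h‖).mono'
    ((Lp.aestronglyMeasurable g).smul continuous_vadd.aestronglyMeasurable) ?_
  exact .of_forall fun t => by rw [norm_smul, DomAddAct.norm_vadd_Lp]

theorem convRep_mul_convRep (g h : Lp ℂ 1 (volume : Measure ℝ)) :
    convRep g * convRep h = convRep (∫ t : ℝ, g t • (DomAddAct.mk (-t) +ᵥ h)) := by
  ext1 ξ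
  rw [← convRepL_apply (∫ t : ℝ, _), ← convRepL.integral_comp_comm (integrable_smul_vadd g h),
    ContinuousLinearMap.integral_apply (convRepL.integrable_comp (integrable_smul_vadd g h)),
    mul_apply_eq_comp, convRep_apply]
  simp only [map_smul, smul_apply, convRepL_apply, ← translationL_mul_convRep, mul_apply_eq_comp]

theorem integrable_conj_comp_neg (g : Lp ℂ 1 (volume : Measure ℝ)) :
    Integrable fun t : ℝ => conj (g (-t)) :=
  (LinearIsometryEquiv.integrable_comp_iff Complex.conjLIE).mpr (L1.integrable_coeFn g).comp_neg

theorem star_convRep (g : Lp ℂ 1 (volume : Measure ℝ)) :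
    star (convRep g) = convRep ((integrable_conj_comp_neg g).toL1 _) := by
  symm
  rw [ContinuousLinearMap.star_eq_adjoint, ContinuousLinearMap.eq_adjoint_iff]
  intro ξ η
  rw [← inner_conj_symm, inner_convRep, inner_convRep, ← integral_conj, ← integral_neg_eq_self]
  refine integral_congr_ae ?_
  filter_upwards [(Measure.measurePreserving_neg volume).quasiMeasurePreserving.ae
    (integrable_conj_comp_neg g).coeFn_toL1] with t ht
  rw [ht, map_mul, neg_neg, Complex.conj_conj, inner_conj_symm, ← neg_neg t, ← star_translationL,
    ContinuousLinearMap.star_eq_adjoint, ContinuousLinearMap.adjoint_inner_left, neg_neg]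

theorem coe_groupCStar : (groupCStar : Set (L2R →L[ℂ] L2R)) = closure (Set.range convRep) := by
  let A : NonUnitalStarSubalgebra ℂ (L2R →L[ℂ] L2R) :=
    { convRepL.range with
      mul_mem' := by
        rintro _ _ ⟨g, rfl⟩ ⟨h, rfl⟩
        exact ⟨_, (convRep_mul_convRep g h).symm⟩
      star_mem' := by
        rintro _ ⟨g, rfl⟩
        exact ⟨_, (star_convRep g).symm⟩ }
  have adjoin_eq : NonUnitalStarAlgebra.adjoin ℂ (Set.range convRep) = A :=
    le_antisymm (NonUnitalStarAlgebra.adjoin_le subset_rfl)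
      (NonUnitalStarAlgebra.subset_adjoin ℂ _)
  rw [groupCStar, adjoin_eq]
  rfl

theorem convRep_mem_groupCStar (g : Lp ℂ 1 (volume : Measure ℝ)) : convRep g ∈ groupCStar := by
  rw [← SetLike.mem_coe, coe_groupCStar]
  exact subset_closure ⟨g, rfl⟩

theorem groupCStar_induction {p : (L2R →L[ℂ] L2R) → Prop} (convRep : ∀ g, p (convRep g))
    (isClosed : IsClosed {G | p G}) {G : L2R →L[ℂ] L2R} (hG : G ∈ groupCStar) : p G := by
  rw [← SetLike.mem_coe, coe_groupCStar] at hG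
  exact closure_minimal (Set.range_subset_iff.mpr convRep) isClosed hG

theorem mul_translationL_comm {G : L2R →L[ℂ] L2R} (hG : G ∈ groupCStar) (s : ℝ) :
    G * translationL s = translationL s * G := by
  refine groupCStar_induction (p := fun G => G * translationL s = translationL s * G)
    (fun g => ?_) (isClosed_eq (by fun_prop) (by fun_prop)) hG
  ext1 ξ
  have hright := mul_convRep_mul_apply 1 (translationL s) g ξ
  have hleft := mul_convRep_mul_apply (translationL s) 1 g ξ
  simp only [mul_one, one_mul, translationL_mul] at hright hleft
  rw [hright, hleft]
  simp only [add_comm]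

/-- The character `x ↦ exp(2πisx)` of the additive group `ℝ`, as a bounded continuous function.
Conjugation by `mulOp (character s)` translates the Fourier transform of an element of the group
C⋆-algebra by `s`. -/
def character (s : ℝ) : ℝ →ᵇ ℂ :=
  BoundedContinuousFunction.char (L := LinearMap.mul ℝ ℝ) Real.continuous_fourierChar
    (show Continuous fun p : ℝ × ℝ => LinearMap.mul ℝ ℝ p.1 p.2 from continuous_mul) s

theorem character_apply (s x : ℝ) : character s x = Real.fourierChar (x * s) := rfl

theorem character_mul_neg (s : ℝ) : character s * character (-s) = 1 := by
  rw [character, character, ← BoundedContinuousFunction.char_add_eq_mul, add_neg_cancel,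
    BoundedContinuousFunction.char_zero_eq_one]

theorem character_add_apply (s x y : ℝ) :
    character s (x + y) = character s x * character s y := by
  rw [character_apply, add_mul, AddChar.map_add_eq_mul, Circle.coe_mul]
  rfl

theorem norm_character_apply (s x : ℝ) : ‖character s x‖ = 1 := Circle.norm_coe _

theorem norm_mulOp_character_le (s : ℝ) : ‖mulOp (character s)‖ ≤ 1 :=
  (norm_mulOp_le _).trans
    ((BoundedContinuousFunction.norm_le zero_le_one).mpr fun x => (norm_character_apply s x).le)

theorem norm_mulOp_character_conj_le (s : ℝ) (A : L2R →L[ℂ] L2R) :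
    ‖mulOp (character s) * A * mulOp (character (-s))‖ ≤ ‖A‖ :=
  calc ‖mulOp (character s) * A * mulOp (character (-s))‖
      ≤ ‖mulOp (character s)‖ * ‖A‖ * ‖mulOp (character (-s))‖ :=
        (norm_mul_le _ _).trans (by gcongr; exact norm_mul_le _ _)
    _ ≤ 1 * ‖A‖ * 1 := by gcongr <;> exact norm_mulOp_character_le _
    _ = ‖A‖ := by ring

theorem mulOp_character_conj_translationL (s t : ℝ) :
    mulOp (character s) * translationL t * mulOp (character (-s)) =
      character s t • translationL t := by
  have shift : (character s).compContinuous (.addRight t) = character s t • character s := by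
    ext x
    exact (character_add_apply s x t).trans (mul_comm _ _)
  rw [mulOp_mul_translationL, shift, map_smul, mul_assoc, smul_mul_assoc, ← map_mul,
    character_mul_neg, map_one, mul_smul_comm, mul_one]

/-- Pointwise multiplication of a fixed integrable function by bounded continuous functions. -/
def mulL1 (g : Lp ℂ 1 (volume : Measure ℝ)) : (ℝ →ᵇ ℂ) →L[ℂ] Lp ℂ 1 (volume : Measure ℝ) :=
  LinearMap.mkContinuous
    { toFun := fun f => (ContinuousLinearMap.mul ℂ ℂ).holderL volume ⊤ 1 1 (f.memLp_top.toLp f) g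
      map_add' := fun f₁ f₂ => (ContinuousLinearMap.mul ℂ ℂ).holder_add_left
        (f₁.memLp_top.toLp f₁) (f₂.memLp_top.toLp f₂) g
      map_smul' := fun c f =>
        (ContinuousLinearMap.mul ℂ ℂ).holder_smul_left c (f.memLp_top.toLp f) g }
    ‖g‖ fun f => by
      rw [mul_comm]
      refine Lp.norm_le_mul_norm_of_ae_le_mul ?_
      filter_upwards [coeFn_mul_holderL f g] with t ht
      refine (congrArg norm ht).trans_le ?_
      rw [norm_mul]
      gcongr
      exact f.norm_coe_le_norm t

theorem mulL1_coeFn (g : Lp ℂ 1 (volume : Measure ℝ)) (f : ℝ →ᵇ ℂ) :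
    mulL1 g f =ᵐ[volume] fun t => f t * g t :=
  coeFn_mul_holderL f g

theorem mulOp_character_conj_convRep_apply (s : ℝ) (g : Lp ℂ 1 (volume : Measure ℝ)) (ξ : L2R) :
    (mulOp (character s) * convRep g * mulOp (character (-s))) ξ =
      ∫ t : ℝ, character s t • g t • translationL t ξ := by
  simp only [mul_convRep_mul_apply, mulOp_character_conj_translationL, smul_apply, smul_comm (g _)]

theorem mulOp_character_conj_convRep (s : ℝ) (g : Lp ℂ 1 (volume : Measure ℝ)) :
    mulOp (character s) * convRep g * mulOp (character (-s)) = convRep (mulL1 g (character s)) := by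
  ext1 ξ
  rw [mulOp_character_conj_convRep_apply, convRep_apply]
  refine integral_congr_ae ?_
  filter_upwards [mulL1_coeFn g (character s)] with t ht
  rw [ht, smul_smul]

theorem mulOp_character_conj_mem_groupCStar (s : ℝ) {G : L2R →L[ℂ] L2R} (hG : G ∈ groupCStar) :
    mulOp (character s) * G * mulOp (character (-s)) ∈ groupCStar := by
  refine groupCStar_induction
    (p := fun G => mulOp (character s) * G * mulOp (character (-s)) ∈ groupCStar) (fun g => ?_)
    ((NonUnitalStarSubalgebra.isClosed_topologicalClosure _).preimage (by fun_prop)) hG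
  rw [mulOp_character_conj_convRep]
  exact convRep_mem_groupCStar _

/-- The Riemann–Lebesgue lemma for the group C⋆-algebra. -/
theorem tendsto_mulOp_character_conj_apply {G : L2R →L[ℂ] L2R} (hG : G ∈ groupCStar) (ξ : L2R) :
    Tendsto (fun s => (mulOp (character s) * G * mulOp (character (-s))) ξ) atTop (𝓝 0) := by
  refine groupCStar_induction (p := fun G => Tendsto (fun s : ℝ =>
    (mulOp (character s) * G * mulOp (character (-s))) ξ) atTop (𝓝 0)) (fun g => ?_) ?_ hG
  · refine ((Real.tendsto_integral_exp_smul_cocompact fun t => g t • translationL t ξ).comp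
      (tendsto_neg_atTop_atBot.mono_right atBot_le_cocompact)).congr fun s => ?_
    simp only [Function.comp_apply, mulOp_character_conj_convRep_apply, character_apply,
      Circle.smul_def, mul_neg, neg_neg]
    rfl
  · refine (LipschitzWith.uniformEquicontinuous (fun s G =>
      (mulOp (character s) * G * mulOp (character (-s))) ξ) ‖ξ‖₊ fun s =>
      LipschitzWith.of_dist_le_mul fun A B => ?_).equicontinuous.isClosed_setOfPred_tendsto
      continuous_const
    rw [dist_eq_norm, dist_eq_norm, ← sub_apply, ← sub_mul, ← mul_sub, mul_comm, coe_nnnorm]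
    exact (ContinuousLinearMap.le_opNorm _ _).trans
      (by gcongr; exact norm_mulOp_character_conj_le s _)

theorem integral_integral_mul_comp_sub {a b : ℝ → ℂ} (ha : Integrable a) (hb : Integrable b) :
    ∫ t, ∫ x, a x * b (x - t) = (∫ x, a x) * ∫ x, b x := by
  have h := integral_convolution (μ := (volume : Measure ℝ)) (ν := volume)
    (ContinuousLinearMap.mul ℝ ℂ) ha hb.comp_neg
  simpa only [convolution_def, ContinuousLinearMap.mul_apply', neg_sub,
    integral_neg_eq_self b] using h

theorem inner_mulOp_translationL_mulOp (φ θ : ℝ →ᵇ ℂ) (t : ℝ) (η ξ : L2R) :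
    inner ℂ η (mulOp φ (translationL t (mulOp θ ξ))) =
      ∫ x, φ x * θ (x - t) * (conj (η x) * ξ (x - t)) := by
  rw [inner_mulOp]
  refine integral_congr_ae ?_
  filter_upwards [translationL_coeFn t (mulOp θ ξ), ae_comp_sub (mulOp_coeFn θ ξ) t] with x ht hθ
  rw [ht, hθ, RCLike.inner_apply]
  ring

/-- The operator `mulOp φ * convRep g * mulOp θ` has kernel `(x, y) ↦ φ x * g (x - y) * θ y`. -/
theorem mulOp_mul_convRep_mul_mulOp_eq_rankOne {φ θ : ℝ →ᵇ ℂ} {g a b : ℝ → ℂ}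
    (hg : Integrable g) (ha : MemLp a 2) (hb : MemLp b 2)
    (kernel : ∀ x y, φ x * g (x - y) * θ y = a x * conj (b y)) :
    mulOp φ * convRep (hg.toL1 g) * mulOp θ =
      InnerProductSpace.rankOne ℂ (ha.toLp a) (hb.toLp b) := by
  ext1 ξ
  refine ext_inner_left ℂ fun η => ?_
  have inner_a : inner ℂ η (ha.toLp a) = ∫ x, conj (η x) * a x := by
    rw [L2.inner_def]
    refine integral_congr_ae ?_
    filter_upwards [ha.coeFn_toLp] with x hx
    rw [hx, RCLike.inner_apply, mul_comm]
  have inner_b : inner ℂ (hb.toLp b) ξ = ∫ x, conj (b x) * ξ x := by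
    rw [L2.inner_def]
    refine integral_congr_ae ?_
    filter_upwards [hb.coeFn_toLp] with x hx
    rw [hx, RCLike.inner_apply, mul_comm]
  have integrable_a : Integrable fun x => conj (η x) * a x := (Lp.memLp η).star.integrable_mul ha
  have integrable_b : Integrable fun x => conj (b x) * ξ x := hb.star.integrable_mul (Lp.memLp ξ)
  rw [InnerProductSpace.rankOne_apply, inner_smul_right, inner_a, inner_b, mul_comm,
    ← integral_integral_mul_comp_sub integrable_a integrable_b, mul_apply_eq_comp,
    mul_apply_eq_comp, ← ContinuousLinearMap.adjoint_inner_left, inner_convRep]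
  refine integral_congr_ae ?_
  filter_upwards [hg.coeFn_toL1] with t ht
  rw [ht, ContinuousLinearMap.adjoint_inner_left, inner_mulOp_translationL_mulOp,
    ← integral_const_mul]
  refine integral_congr_ae (.of_forall fun x => ?_)
  have hx := kernel x (x - t)
  rw [sub_sub_cancel] at hx
  linear_combination (conj (η x) * ξ (x - t)) * hx

/-- The `T`-periodic function on `ℝ` given by a continuous function on the circle `ℝ / Tℤ`. -/
def ofAddCircle {T : ℝ} [Fact (0 < T)] (q : C(AddCircle T, ℂ)) : ℝ →ᵇ ℂ :=
  (BoundedContinuousFunction.mkOfCompact q).compContinuous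
    ⟨fun x : ℝ => (x : AddCircle T), AddCircle.continuous_mk' T⟩

theorem ofAddCircle_mem_closure_span_character {T : ℝ} [Fact (0 < T)] (q : C(AddCircle T, ℂ)) :
    ofAddCircle q ∈ (Submodule.span ℂ (Set.range character)).topologicalClosure := by
  let periodic : C(AddCircle T, ℂ) →ₗ[ℂ] (ℝ →ᵇ ℂ) :=
    { toFun := ofAddCircle
      map_add' := fun _ _ => rfl
      map_smul' := fun _ _ => rfl }
  have continuous_periodic : Continuous periodic :=
    (BoundedContinuousFunction.continuous_compContinuous _).comp
      (ContinuousMap.isometryEquivBoundedOfCompact _ _).continuous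
  have span_le : Submodule.span ℂ (Set.range (fourier (T := T))) ≤
      (Submodule.span ℂ (Set.range character)).topologicalClosure.comap periodic := by
    refine Submodule.span_le.mpr (Set.range_subset_iff.mpr fun n => ?_)
    refine Submodule.le_topologicalClosure _ (Submodule.subset_span ⟨n / T, ?_⟩)
    ext x
    change _ = fourier n (x : AddCircle T)
    rw [fourier_coe_apply, character_apply, Real.fourierChar_apply]
    congr 1
    push_cast
    ring
  have closure_le := Submodule.topologicalClosure_minimal _ span_le
    ((Submodule.isClosed_topologicalClosure _).preimage continuous_periodic)
  rw [span_fourier_closure_eq_top] at closure_le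
  exact closure_le (Submodule.mem_top (x := q))

theorem isCompactOperator_of_mem_closure_span_character {φ θ : ℝ →ᵇ ℂ}
    {g : Lp ℂ 1 (volume : Measure ℝ)}
    (h : IsCompactOperator (mulOp φ * convRep g * mulOp θ)) {f : ℝ →ᵇ ℂ}
    (hf : f ∈ (Submodule.span ℂ (Set.range character)).topologicalClosure) :
    IsCompactOperator (mulOp φ * convRep (mulL1 g f) * mulOp θ) := by
  let sandwich : (ℝ →ᵇ ℂ) →ₗ[ℂ] (L2R →L[ℂ] L2R) :=
    LinearMap.mulLeftRight ℂ (mulOp φ, mulOp θ) ∘ₗ convRepL.toLinearMap ∘ₗ (mulL1 g).toLinearMap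
  have continuous_sandwich : Continuous sandwich := by
    change Continuous fun f => mulOp φ * convRepL (mulL1 g f) * mulOp θ
    fun_prop
  have span_le : Submodule.span ℂ (Set.range character) ≤
      (compactOperator (.id ℂ) L2R L2R).comap sandwich := by
    refine Submodule.span_le.mpr (Set.range_subset_iff.mpr fun s => ?_)
    change IsCompactOperator (mulOp φ * convRep (mulL1 g (character s)) * mulOp θ)
    have commute : mulOp φ * convRep (mulL1 g (character s)) * mulOp θ =
        mulOp (character s) * (mulOp φ * convRep g * mulOp θ) * mulOp (character (-s)) := by
      rw [← mulOp_character_conj_convRep, ← mul_assoc, ← mul_assoc, ← mul_assoc, ← map_mul,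
        mul_comm φ, map_mul, mul_assoc _ (mulOp (character (-s))), ← map_mul mulOp (character (-s)),
        mul_comm (character (-s)), map_mul]
      simp only [mul_assoc]
    rw [commute]
    exact (h.clm_comp (mulOp (character s))).comp_clm (mulOp (character (-s)))
  exact Submodule.topologicalClosure_minimal _ span_le
    (isClosed_setOfPred_isCompactOperator.preimage continuous_sandwich) hf

/-- The piecewise linear cutoff function that rises from `0` on `(-∞, 0]` to `1` on `[1, ∞)`. -/
def ramp : ℝ →ᵇ ℂ :=
  .ofNormedAddCommGroup (fun x => ((max 0 (min 1 x) : ℝ) : ℂ)) (by fun_prop) 1 fun x => by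
    rw [Complex.norm_real, Real.norm_of_nonneg (le_max_left _ _)]
    exact max_le zero_le_one (min_le_left _ _)

theorem ramp_apply (x : ℝ) : ramp x = ((max 0 (min 1 x) : ℝ) : ℂ) :=
  rfl

theorem ramp_of_nonpos {x : ℝ} (hx : x ≤ 0) : ramp x = 0 := by
  rw [ramp_apply, max_eq_left ((min_le_right _ _).trans hx), Complex.ofReal_zero]

theorem ramp_of_one_le {x : ℝ} (hx : 1 ≤ x) : ramp x = 1 := by
  rw [ramp_apply, min_eq_left hx, max_eq_right zero_le_one, Complex.ofReal_one]

theorem norm_ramp_apply_le (x : ℝ) : ‖ramp x‖ ≤ 1 := by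
  rw [ramp_apply, Complex.norm_real, Real.norm_of_nonneg (le_max_left _ _)]
  exact max_le zero_le_one (min_le_left _ _)

theorem norm_ramp_apply_sub_one_le (x : ℝ) : ‖ramp x - 1‖ ≤ 1 := by
  rw [ramp_apply, ← Complex.ofReal_one, ← Complex.ofReal_sub, Complex.norm_real, Real.norm_eq_abs,
    abs_sub_comm, abs_of_nonneg (sub_nonneg.mpr (max_le zero_le_one (min_le_left _ _)))]
  exact sub_le_self _ (le_max_left _ _)

/-- The piecewise linear bump function equal to `1` on `[-R, R]` and to `0` outside
`[-R - 1, R + 1]`. -/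
def plateau (R : ℝ) : ℝ →ᵇ ℂ :=
  ramp.compContinuous ⟨fun x => R + 1 - |x|, by fun_prop⟩

theorem plateau_of_abs_le {R x : ℝ} (hx : |x| ≤ R) : plateau R x = 1 :=
  ramp_of_one_le (by change 1 ≤ R + 1 - |x|; linarith)

theorem plateau_of_add_one_le_abs {R x : ℝ} (hx : R + 1 ≤ |x|) : plateau R x = 0 :=
  ramp_of_nonpos (by change R + 1 - |x| ≤ 0; linarith)

theorem norm_plateau_apply_sub_one_le (R x : ℝ) : ‖plateau R x - 1‖ ≤ 1 :=
  norm_ramp_apply_sub_one_le _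

theorem norm_plateau_le (R : ℝ) : ‖plateau R‖ ≤ 1 :=
  (BoundedContinuousFunction.norm_le zero_le_one).mpr fun _ => norm_ramp_apply_le _

theorem hasCompactSupport_plateau (R : ℝ) : HasCompactSupport (plateau R) :=
  HasCompactSupport.intro (isCompact_closedBall 0 (R + 1)) fun x hx =>
    plateau_of_add_one_le_abs (by
      rw [mem_closedBall_zero_iff, Real.norm_eq_abs, not_le] at hx
      exact hx.le)

theorem tendsto_plateau_apply (x : ℝ) : Tendsto (fun n : ℕ => plateau n x) atTop (𝓝 1) :=
  tendsto_const_nhds.congr' <| (tendsto_natCast_atTop_atTop.eventually_ge_atTop |x|).mono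
    fun _ hn => (plateau_of_abs_le hn).symm

theorem tendsto_mulOp_plateau_apply (ξ : L2R) :
    Tendsto (fun n : ℕ => mulOp (plateau n) ξ) atTop (𝓝 ξ) := by
  have h := tendsto_mulOp_apply (g := 1) (fun n : ℕ => norm_plateau_le n) tendsto_plateau_apply ξ
  rwa [map_one, one_apply_eq_self] at h

theorem tendsto_mul_plateau {f : ℝ →ᵇ ℂ} (hf : Tendsto f (cocompact ℝ) (𝓝 0)) :
    Tendsto (fun n : ℕ => f * plateau n) atTop (𝓝 f) := by
  rw [BoundedContinuousFunction.tendsto_iff_tendstoUniformly, Metric.tendstoUniformly_iff]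
  intro ε hε
  obtain ⟨R, hR⟩ := (Metric.closedBall_compl_subset_of_mem_cocompact
    (hf.eventually (Metric.ball_mem_nhds 0 hε))) 0
  filter_upwards [tendsto_natCast_atTop_atTop.eventually_ge_atTop R] with n hn x
  rw [dist_comm, dist_eq_norm, BoundedContinuousFunction.mul_apply, ← mul_sub_one, norm_mul]
  rcases le_or_gt |x| n with hx | hx
  · rwa [plateau_of_abs_le hx, sub_self, norm_zero, mul_zero]
  · have small : ‖f x‖ < ε := by
      refine mem_ball_zero_iff.mp (hR ?_)
      rw [Set.mem_compl_iff, mem_closedBall_zero_iff, Real.norm_eq_abs, not_le]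
      exact hn.trans_lt hx
    exact (mul_le_of_le_one_right (norm_nonneg _) (norm_plateau_apply_sub_one_le _ _)).trans_lt
      small

theorem isCompactOperator_mulOp_mul_convRep_indicator_mul_mulOp {φ θ : ℝ →ᵇ ℂ}
    (hφ : HasCompactSupport φ) (hθ : HasCompactSupport θ) {L : ℝ}
    (hL : ∀ x y, φ x ≠ 0 → θ y ≠ 0 → |x - y| ≤ L)
    (h1 : Integrable ((Set.Icc (-L) L).indicator (1 : ℝ → ℂ))) :
    IsCompactOperator (mulOp φ * convRep (h1.toL1 _) * mulOp θ) := by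
  rw [mulOp_mul_convRep_mul_mulOp_eq_rankOne h1 (φ.continuous.memLp_of_hasCompactSupport hφ)
    (b := star θ) ((star θ).continuous.memLp_of_hasCompactSupport ?_) fun x y => ?_]
  · exact isCompactOperator_rankOne _ _
  · exact hθ.comp_left (star_zero ℂ)
  · rw [Pi.star_apply, starRingEnd_apply, star_star]
    by_cases hx : φ x = 0
    · simp only [hx, zero_mul]
    by_cases hy : θ y = 0
    · simp only [hy, mul_zero]
    rw [Set.indicator_of_mem (Set.mem_Icc.mpr (abs_le.mp (hL x y hx hy))), Pi.one_apply, mul_one]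

theorem exists_toL1_eq_mulL1_indicator {L : ℝ} [Fact (0 < 2 * L)] {g : ℝ → ℂ}
    (hg : Integrable g) (continuous_g : Continuous g) (hL : ∀ x, L ≤ |x| → g x = 0)
    (h1 : Integrable ((Set.Icc (-L) L).indicator (1 : ℝ → ℂ))) :
    ∃ q : C(AddCircle (2 * L), ℂ), hg.toL1 g = mulL1 (h1.toL1 _) (ofAddCircle q) := by
  have periodic_g : g (-L) = g (-L + 2 * L) := by
    rw [show -L + 2 * L = L by ring, hL L (le_abs_self L), hL (-L) ((le_abs_self L).trans_eq
      (abs_neg L).symm)]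
  let q : C(AddCircle (2 * L), ℂ) :=
    ⟨AddCircle.liftIco (2 * L) (-L) g,
      AddCircle.liftIco_continuous periodic_g continuous_g.continuousOn⟩
  refine ⟨q, Lp.ext ?_⟩
  filter_upwards [hg.coeFn_toL1, h1.coeFn_toL1, mulL1_coeFn (h1.toL1 _) (ofAddCircle q),
    compl_mem_ae_iff.mpr (measure_singleton L)] with x hgx h1x hx x_ne
  rw [hgx, hx, h1x]
  by_cases mem : x ∈ Set.Icc (-L) L
  · rw [Set.indicator_of_mem mem, Pi.one_apply, mul_one]
    refine (AddCircle.liftIco_coe_apply ⟨mem.1, ?_⟩).symm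
    rw [show -L + 2 * L = L by ring]
    exact lt_of_le_of_ne mem.2 x_ne
  · rw [Set.mem_Icc, ← abs_le, not_le] at mem
    rw [Set.indicator_of_notMem, mul_zero, hL x mem.le]
    rwa [Set.mem_Icc, ← abs_le, not_le]

theorem isCompactOperator_mulOp_mul_convRep_mul_mulOp {φ θ : ℝ →ᵇ ℂ}
    (hφ : HasCompactSupport φ) (hθ : HasCompactSupport θ) {g : ℝ → ℂ} (hg : Integrable g)
    (continuous_g : Continuous g) (support_g : HasCompactSupport g) :
    IsCompactOperator (mulOp φ * convRep (hg.toL1 g) * mulOp θ) := by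
  obtain ⟨a, a_pos, ha⟩ := hφ.exists_pos_le_norm
  obtain ⟨b, b_pos, hb⟩ := hθ.exists_pos_le_norm
  obtain ⟨r, r_pos, hr⟩ := support_g.exists_pos_le_norm
  let L := a + b + r
  have : Fact (0 < 2 * L) := ⟨by positivity⟩
  have h1 : Integrable ((Set.Icc (-L) L).indicator (1 : ℝ → ℂ)) :=
    (integrable_indicator_iff measurableSet_Icc).mpr continuous_one.integrableOn_Icc
  obtain ⟨q, hq⟩ := exists_toL1_eq_mulL1_indicator hg continuous_g
    (fun x (hx : L ≤ |x|) => hr x (hx.trans' (by linarith))) h1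
  rw [hq]
  refine isCompactOperator_of_mem_closure_span_character
    (isCompactOperator_mulOp_mul_convRep_indicator_mul_mulOp hφ hθ (fun x y hx hy => ?_) h1)
    (ofAddCircle_mem_closure_span_character q)
  have hx : |x| < a := not_le.mp fun h => hx (ha x h)
  have hy : |y| < b := not_le.mp fun h => hy (hb y h)
  exact (abs_sub _ _).trans (by linarith)

theorem mulOp_mul_convRep_mul_mulOp_plateau {φ : ℝ →ᵇ ℂ} {R r : ℝ} (hφ : ∀ x, R ≤ |x| → φ x = 0)
    {g : ℝ → ℂ} (hg : Integrable g) (hr : ∀ x, r ≤ |x| → g x = 0) :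
    mulOp φ * convRep (hg.toL1 g) * mulOp (plateau (R + r)) = mulOp φ * convRep (hg.toL1 g) := by
  have kernel (x y : ℝ) : φ x * g (x - y) * (1 - plateau (R + r)) y = 0 * conj 0 := by
    rw [zero_mul]
    rcases le_or_gt R |x| with hx | hx
    · rw [hφ x hx, zero_mul, zero_mul]
    rcases le_or_gt r |x - y| with hxy | hxy
    · rw [hr _ hxy, mul_zero, zero_mul]
    have hy : |y| ≤ R + r := by
      rw [← sub_sub_cancel x y]
      exact (abs_sub _ _).trans (add_le_add hx.le hxy.le)
    rw [BoundedContinuousFunction.sub_apply, plateau_of_abs_le hy]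
    simp
  have remainder := mulOp_mul_convRep_mul_mulOp_eq_rankOne hg MemLp.zero MemLp.zero kernel
  rw [MemLp.toLp_zero, map_zero, map_sub, map_one, mul_sub, mul_one, sub_eq_zero] at remainder
  exact remainder.symm

theorem groupCStar_induction_of_hasCompactSupport {p : (L2R →L[ℂ] L2R) → Prop}
    (hp : IsClosed {G | p G})
    (convRep : ∀ (g : ℝ → ℂ) (hg : Integrable g), Continuous g → HasCompactSupport g →
      p (convRep (hg.toL1 g))) {G : L2R →L[ℂ] L2R} (hG : G ∈ groupCStar) : p G := by
  refine groupCStar_induction (fun k => ?_) hp hG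
  have closed : IsClosed {k : Lp ℂ 1 (volume : Measure ℝ) | p (convRepL k)} :=
    hp.preimage convRepL.continuous
  refine closed.closure_subset (Metric.mem_closure_iff.mpr fun ε hε => ?_)
  obtain ⟨g, support_g, approx, continuous_g, hg⟩ :=
    (L1.integrable_coeFn k).exists_hasCompactSupport_integral_sub_le (half_pos hε)
  refine ⟨hg.toL1 g, convRep g hg continuous_g support_g, ?_⟩
  rw [dist_eq_norm, L1.norm_eq_integral_norm]
  refine (approx.trans' (integral_congr_ae ?_).le).trans_lt (half_lt_self hε)
  filter_upwards [Lp.coeFn_sub k (hg.toL1 g), hg.coeFn_toL1] with x sub_x toL1_x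
  rw [sub_x, Pi.sub_apply, toL1_x]

theorem isCompactOperator_mulOp_mul_of_hasCompactSupport {φ : ℝ →ᵇ ℂ}
    (hφ : HasCompactSupport φ) {G : L2R →L[ℂ] L2R} (hG : G ∈ groupCStar) :
    IsCompactOperator (mulOp φ * G) := by
  refine groupCStar_induction_of_hasCompactSupport (p := fun G => IsCompactOperator (mulOp φ * G))
    (isClosed_setOfPred_isCompactOperator.preimage (continuous_const_mul _))
    (fun g hg continuous_g support_g => ?_) hG
  obtain ⟨R, -, hR⟩ := hφ.exists_pos_le_norm
  obtain ⟨r, -, hr⟩ := support_g.exists_pos_le_norm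
  rw [← mulOp_mul_convRep_mul_mulOp_plateau hR hg hr]
  exact isCompactOperator_mulOp_mul_convRep_mul_mulOp hφ (hasCompactSupport_plateau _) hg
    continuous_g support_g

theorem isCompactOperator_mulOp_mul {f : ℝ →ᵇ ℂ} (hf : Tendsto f (cocompact ℝ) (𝓝 0))
    {G : L2R →L[ℂ] L2R} (hG : G ∈ groupCStar) : IsCompactOperator (mulOp f * G) := by
  refine isClosed_setOfPred_isCompactOperator.mem_of_tendsto
    (((continuous_mulOp.tendsto f).comp (tendsto_mul_plateau hf)).mul_const G)
    (.of_forall fun n => isCompactOperator_mulOp_mul_of_hasCompactSupport ?_ hG)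
  rw [BoundedContinuousFunction.coe_mul]
  exact (hasCompactSupport_plateau n).mul_left

theorem integrable_smul_mul_translationL_mul (A B : L2R →L[ℂ] L2R)
    (g : Lp ℂ 1 (volume : Measure ℝ)) (ξ : L2R) :
    Integrable fun t : ℝ => g t • (A * translationL t * B) ξ := by
  have h := A.integrable_comp (integrable_smul_translationL g (B ξ))
  simp only [map_smul] at h
  exact h

theorem mulOp_mul_lie_convRep_apply (f ψ : ℝ →ᵇ ℂ) (g : Lp ℂ 1 (volume : Measure ℝ)) (ξ : L2R) :
    (mulOp f * ⁅mulOp ψ, convRep g⁆) ξ = ∫ t, g t •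
      mulOp (f * (ψ - ψ.compContinuous (.addRight (-t)))) (translationL t ξ) := by
  have translate (t : ℝ) : translationL t * mulOp ψ =
      mulOp (ψ.compContinuous (.addRight (-t))) * translationL t := by
    rw [mulOp_mul_translationL]
    congr 2
    ext x
    exact congrArg ψ (add_neg_cancel_right x t).symm
  have left := mul_convRep_mul_apply (mulOp (f * ψ)) 1 g ξ
  have right := mul_convRep_mul_apply (mulOp f) (mulOp ψ) g ξ
  rw [mul_one] at left
  rw [Ring.lie_def, mul_sub, ← mul_assoc, ← mul_assoc, ← map_mul, sub_apply, left, right,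
    ← integral_sub (integrable_smul_mul_translationL_mul _ _ g ξ)
      (integrable_smul_mul_translationL_mul _ _ g ξ)]
  refine integral_congr_ae (.of_forall fun t => ?_)
  beta_reduce
  rw [mul_assoc (mulOp f), translate, mul_one, mul_sub, map_sub,
    map_mul mulOp f (ψ.compContinuous _), sub_apply, smul_sub]
  rfl

theorem norm_mulOp_mul_lie_convRep_le {f ψ : ℝ →ᵇ ℂ} {g : Lp ℂ 1 (volume : Measure ℝ)} {C : ℝ}
    (hC : 0 ≤ C) (h : ∀ᵐ t, g t ≠ 0 → ∀ x, ‖f x * (ψ x - ψ (x - t))‖ ≤ C) :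
    ‖mulOp f * ⁅mulOp ψ, convRep g⁆‖ ≤ C * ‖g‖ := by
  refine ContinuousLinearMap.opNorm_le_bound _ (by positivity) fun ξ => ?_
  rw [mulOp_mul_lie_convRep_apply, L1.norm_eq_integral_norm, ← integral_const_mul,
    ← integral_mul_const]
  refine norm_integral_le_of_norm_le
    (((L1.integrable_coeFn g).norm.const_mul C).mul_const _) ?_
  filter_upwards [h] with t ht
  rw [norm_smul]
  by_cases hg : g t = 0
  · rw [hg, norm_zero, zero_mul, mul_zero, zero_mul]
  have norm_le : ‖f * (ψ - ψ.compContinuous (.addRight (-t)))‖ ≤ C :=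
    (BoundedContinuousFunction.norm_le hC).mpr (ht hg)
  calc ‖g t‖ * ‖mulOp (f * (ψ - ψ.compContinuous (.addRight (-t)))) (translationL t ξ)‖
      ≤ ‖g t‖ * (C * ‖ξ‖) := by
        rw [← norm_translationL_apply t ξ]
        gcongr
        exact ContinuousLinearMap.le_of_opNorm_le _ ((norm_mulOp_le _).trans norm_le) _
    _ = C * ‖g t‖ * ‖ξ‖ := by ring

theorem isCompactOperator_mulOp_mul_lie_of_hasCompactSupport {φ : ℝ →ᵇ ℂ}
    (hφ : HasCompactSupport φ) (ψ : ℝ →ᵇ ℂ) {G : L2R →L[ℂ] L2R} (hG : G ∈ groupCStar) :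
    IsCompactOperator (mulOp φ * ⁅mulOp ψ, G⁆) := by
  rw [Ring.lie_def, mul_sub, ← mul_assoc, ← mul_assoc, ← map_mul]
  refine (isCompactOperator_mulOp_mul_of_hasCompactSupport ?_ hG).sub
    ((isCompactOperator_mulOp_mul_of_hasCompactSupport hφ hG).comp_clm (mulOp ψ))
  rw [BoundedContinuousFunction.coe_mul]
  exact hφ.mul_right

theorem tendsto_mulOp_mul_plateau_mul_lie_convRep {f ψ : ℝ →ᵇ ℂ}
    {g : Lp ℂ 1 (volume : Measure ℝ)} {r : ℝ}
    (h : Tendsto (fun p : ℝ × ℝ => f p.1 * (ψ p.1 - ψ (p.1 - p.2)))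
      (cocompact ℝ ×ˢ 𝓟 (Metric.closedBall 0 r)) (𝓝 0))
    (hr : ∀ᵐ t, r ≤ |t| → g t = 0) :
    Tendsto (fun n : ℕ => mulOp (f * plateau n) * ⁅mulOp ψ, convRep g⁆) atTop
      (𝓝 (mulOp f * ⁅mulOp ψ, convRep g⁆)) := by
  refine Metric.tendsto_nhds.mpr fun ε hε => ?_
  have oscillation : ∀ᶠ x in cocompact ℝ, ∀ t ∈ Metric.closedBall (0 : ℝ) r,
      ‖f x * (ψ x - ψ (x - t))‖ ≤ ε / (‖g‖ + 1) := by
    refine (eventually_prod_principal_iff.mp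
      (h.eventually (Metric.ball_mem_nhds 0 (ε := ε / (‖g‖ + 1)) (by positivity)))).mono ?_
    exact fun x hx t ht => (mem_ball_zero_iff.mp (hx t ht)).le
  obtain ⟨R, hR⟩ := (Metric.closedBall_compl_subset_of_mem_cocompact oscillation) 0
  filter_upwards [tendsto_natCast_atTop_atTop.eventually_ge_atTop R] with n hn
  rw [dist_eq_norm, ← sub_mul, ← map_sub]
  refine (norm_mulOp_mul_lie_convRep_le (by positivity : 0 ≤ ε / (‖g‖ + 1)) ?_).trans_lt ?_
  · filter_upwards [hr] with t ht g_ne x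
    rw [BoundedContinuousFunction.sub_apply, BoundedContinuousFunction.mul_apply, ← mul_sub_one,
      mul_right_comm, norm_mul]
    rcases le_or_gt |x| n with hx | hx
    · rw [plateau_of_abs_le hx, sub_self, norm_zero, mul_zero]
      positivity
    · have hRx : x ∈ (Metric.closedBall (0 : ℝ) R)ᶜ := by
        rw [Set.mem_compl_iff, mem_closedBall_zero_iff, Real.norm_eq_abs, not_le]
        exact hn.trans_lt hx
      have t_mem : t ∈ Metric.closedBall (0 : ℝ) r :=
        mem_closedBall_zero_iff.mpr (le_of_not_ge fun hrt => g_ne (ht hrt))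
      exact (mul_le_of_le_one_right (norm_nonneg _) (norm_plateau_apply_sub_one_le _ _)).trans
        (hR hRx t t_mem)
  · rw [div_mul_eq_mul_div, div_lt_iff₀ (by positivity)]
    nlinarith

theorem isCompactOperator_mulOp_mul_lie {f ψ : ℝ →ᵇ ℂ}
    (h : ∀ r, Tendsto (fun p : ℝ × ℝ => f p.1 * (ψ p.1 - ψ (p.1 - p.2)))
      (cocompact ℝ ×ˢ 𝓟 (Metric.closedBall 0 r)) (𝓝 0))
    {G : L2R →L[ℂ] L2R} (hG : G ∈ groupCStar) : IsCompactOperator (mulOp f * ⁅mulOp ψ, G⁆) := by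
  refine groupCStar_induction_of_hasCompactSupport
    (p := fun G => IsCompactOperator (mulOp f * ⁅mulOp ψ, G⁆))
    (isClosed_setOfPred_isCompactOperator.preimage (f := fun G => mulOp f * ⁅mulOp ψ, G⁆)
      (by simp only [Ring.lie_def]; fun_prop)) (fun g hg _ support_g => ?_) hG
  obtain ⟨r, -, hr⟩ := support_g.exists_pos_le_norm
  have support_toL1 : ∀ᵐ t, r ≤ |t| → hg.toL1 g t = 0 :=
    hg.coeFn_toL1.mono fun t ht hrt => ht.trans (hr t hrt)
  refine isClosed_setOfPred_isCompactOperator.mem_of_tendsto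
    (tendsto_mulOp_mul_plateau_mul_lie_convRep (h r) support_toL1) (.of_forall fun n =>
      isCompactOperator_mulOp_mul_lie_of_hasCompactSupport ?_ ψ (convRep_mem_groupCStar _))
  rw [BoundedContinuousFunction.coe_mul]
  exact (hasCompactSupport_plateau n).mul_left

/-- `ψ` is slowly varying at `+∞`: on intervals of bounded length, its oscillation tends to zero as
the interval moves to `+∞`. -/
def SlowlyVarying {E : Type*} [AddGroup E] [TopologicalSpace E] (ψ : ℝ → E) : Prop :=
  ∀ r, Tendsto (fun p : ℝ × ℝ => ψ p.1 - ψ (p.1 - p.2)) (atTop ×ˢ 𝓟 (Metric.closedBall 0 r)) (𝓝 0)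

theorem slowlyVarying_of_tendsto_deriv {E : Type*} [NormedAddCommGroup E] [NormedSpace ℝ E]
    {ψ : ℝ → E} (hψ : Differentiable ℝ ψ) (h : Tendsto (deriv ψ) atTop (𝓝 0)) :
    SlowlyVarying ψ := by
  refine fun r => Metric.tendsto_nhds.mpr fun ε hε => eventually_prod_principal_iff.mpr ?_
  obtain ⟨N, hN⟩ := eventually_atTop.mp
    (h.eventually (Metric.closedBall_mem_nhds 0 (ε := ε / (|r| + 1)) (by positivity)))
  filter_upwards [eventually_ge_atTop (N + |r|)] with x hx t ht
  have t_le : |t| ≤ |r| := (mem_closedBall_zero_iff.mp ht).trans (le_abs_self r)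
  have x_mem : x ∈ Set.Ici N := (le_add_of_nonneg_right (abs_nonneg r)).trans hx
  have x_sub_mem : x - t ∈ Set.Ici N := by
    rw [Set.mem_Ici]
    linarith [le_abs_self t]
  rw [dist_zero_right]
  calc ‖ψ x - ψ (x - t)‖ ≤ ε / (|r| + 1) * ‖x - (x - t)‖ :=
        (convex_Ici N).norm_image_sub_le_of_norm_deriv_le (fun y _ => hψ y)
          (fun y hy => mem_closedBall_zero_iff.mp (hN y hy)) x_sub_mem x_mem
    _ ≤ ε / (|r| + 1) * |r| := by
        rw [sub_sub_cancel, Real.norm_eq_abs]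
        gcongr
    _ < ε := by
        rw [div_mul_eq_mul_div, div_lt_iff₀ (by positivity)]
        linarith

theorem tendsto_deriv_symm {u : DiffeoR} (hu : OrientationPreserving u)
    (hlim : Tendsto (deriv u) atTop atTop) : Tendsto (deriv u.symm) atTop (𝓝 0) := by
  have symm_atTop : Tendsto u.symm atTop atTop :=
    (strictMono_of_deriv_pos hu.symm).monotone.tendsto_atTop_atTop fun x =>
      ⟨u x, (u.symm_apply_apply x).ge⟩
  refine (hlim.comp symm_atTop).inv_tendsto_atTop.congr fun y => ?_
  have h := deriv_mul_deriv_symm u (u.symm y)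
  rw [u.apply_symm_apply] at h
  exact (eq_inv_of_mul_eq_one_right h).symm

theorem slowlyVarying_character_comp_symm {u : DiffeoR} (hu : OrientationPreserving u)
    (hlim : Tendsto (deriv u) atTop atTop) (s : ℝ) :
    SlowlyVarying fun x => character s (u.symm x) := by
  have hasDerivAt_comp (x : ℝ) : HasDerivAt (fun x => character s (u.symm x))
      ((deriv u.symm x * s) • (2 * Real.pi * Complex.I * character s (u.symm x))) x :=
    (Real.hasDerivAt_fourierChar _).scomp (h := fun x => u.symm x * s) x
      ((hasDerivAt u.symm x).mul_const s)
  refine slowlyVarying_of_tendsto_deriv (fun x => (hasDerivAt_comp x).differentiableAt) ?_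
  rw [funext fun x => (hasDerivAt_comp x).deriv]
  have h := (tendsto_deriv_symm hu hlim).mul_const s
  rw [zero_mul] at h
  refine h.zero_smul_isBoundedUnder_le ⟨2 * Real.pi, eventually_map.mpr (.of_forall fun x => ?_)⟩
  simp [norm_character_apply, abs_of_pos Real.pi_pos]

theorem tendsto_ramp_atTop : Tendsto ramp atTop (𝓝 1) :=
  tendsto_const_nhds.congr' ((eventually_ge_atTop 1).mono fun _ hx => (ramp_of_one_le hx).symm)

theorem tendsto_ramp_atBot : Tendsto ramp atBot (𝓝 0) :=
  tendsto_const_nhds.congr' ((eventually_le_atBot 0).mono fun _ hx => (ramp_of_nonpos hx).symm)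

theorem star_mulOp_ramp : star (mulOp ramp) = mulOp ramp := by
  rw [← map_star]
  congr 1
  ext x
  exact Complex.conj_ofReal _

theorem isCompactOperator_lie_ramp {G : L2R →L[ℂ] L2R} (hG : G ∈ groupCStar) :
    IsCompactOperator (⁅mulOp ramp, G⁆ : L2R →L[ℂ] L2R) := by
  rw [← one_mul ⁅mulOp ramp, G⁆, ← map_one mulOp]
  refine isCompactOperator_mulOp_mul_lie (fun r => tendsto_const_nhds.congr' ?_) hG
  refine eventually_prod_principal_iff.mpr ?_
  filter_upwards [(isCompact_closedBall (0 : ℝ) (|r| + 1)).compl_mem_cocompact] with x hx t ht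
  have t_le : |t| ≤ |r| := (mem_closedBall_zero_iff.mp ht).trans (le_abs_self r)
  rw [Set.mem_compl_iff, mem_closedBall_zero_iff, Real.norm_eq_abs, not_le] at hx
  rw [BoundedContinuousFunction.coe_one, Pi.one_apply, one_mul, eq_comm, sub_eq_zero]
  rcases lt_abs.mp hx with hx | hx
  · rw [ramp_of_one_le (by linarith [abs_nonneg r]), ramp_of_one_le (by linarith [le_abs_self t])]
  · rw [ramp_of_nonpos (by linarith [abs_nonneg r]), ramp_of_nonpos (by linarith [neg_abs_le t])]

theorem isCompactOperator_ramp_mul_lie {ψ : ℝ →ᵇ ℂ} (hψ : SlowlyVarying ψ)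
    {G : L2R →L[ℂ] L2R} (hG : G ∈ groupCStar) :
    IsCompactOperator (mulOp ramp * ⁅mulOp ψ, G⁆) := by
  refine isCompactOperator_mulOp_mul_lie (fun r => ?_) hG
  rw [cocompact_eq_atBot_atTop, sup_prod, tendsto_sup]
  constructor
  · refine (tendsto_ramp_atBot.comp tendsto_fst).zero_mul_isBoundedUnder_le
      ⟨‖ψ‖ + ‖ψ‖, eventually_map.mpr (.of_forall fun p => ?_)⟩
    exact (norm_sub_le _ _).trans (add_le_add (ψ.norm_coe_le_norm _) (ψ.norm_coe_le_norm _))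
  · have h := (tendsto_ramp_atTop.comp tendsto_fst).mul (hψ r)
    rwa [mul_zero] at h

theorem isCompactOperator_ramp_mul_ramp_sub_one_mul {G : L2R →L[ℂ] L2R} (hG : G ∈ groupCStar) :
    IsCompactOperator (mulOp ramp * (mulOp ramp - 1) * G : L2R →L[ℂ] L2R) := by
  rw [← map_one mulOp, ← map_sub mulOp, ← map_mul mulOp]
  refine isCompactOperator_mulOp_mul ?_ hG
  rw [cocompact_eq_atBot_atTop, tendsto_sup]
  constructor
  · have h := tendsto_ramp_atBot.mul (tendsto_ramp_atBot.sub_const 1)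
    rwa [zero_mul] at h
  · have h := tendsto_ramp_atTop.mul (tendsto_ramp_atTop.sub_const 1)
    rwa [sub_self, mul_zero] at h

theorem tendsto_inner_mulOp_translationL {f : ℝ →ᵇ ℂ} (hf : Tendsto f atTop (𝓝 0)) (η ξ : L2R) :
    Tendsto (fun t => inner ℂ (mulOp f η) (translationL t ξ)) atTop (𝓝 0) := by
  have tendsto_star := hf.star
  rw [star_zero] at tendsto_star
  have h := (tendsto_mulOp_addRight (f := star f) tendsto_star ξ).norm.const_mul ‖η‖
  rw [zero_smul, norm_zero, mul_zero] at h
  refine squeeze_zero_norm (fun t => ?_) h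
  rw [← ContinuousLinearMap.adjoint_inner_right, ← ContinuousLinearMap.star_eq_adjoint, ← map_star,
    ← mul_apply_eq_comp, mulOp_mul_translationL, mul_apply_eq_comp]
  exact (norm_inner_le_norm _ _).trans_eq (by rw [norm_translationL_apply])

theorem tendsto_inner_translationL (η ξ : L2R) :
    Tendsto (fun t => inner ℂ η (translationL t ξ)) atTop (𝓝 0) := by
  have isClosed : IsClosed {η | Tendsto (fun t => inner ℂ η (translationL t ξ)) atTop (𝓝 0)} := by
    refine (LipschitzWith.uniformEquicontinuous (fun t η => inner ℂ η (translationL t ξ)) ‖ξ‖₊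
      fun t => LipschitzWith.of_dist_le_mul fun x y => ?_).equicontinuous.isClosed_setOfPred_tendsto
      continuous_const
    rw [dist_eq_norm, dist_eq_norm, ← inner_sub_left, mul_comm, coe_nnnorm,
      ← norm_translationL_apply t ξ]
    exact norm_inner_le_norm _ _
  refine isClosed.mem_of_tendsto (tendsto_mulOp_plateau_apply η) (.of_forall fun n => ?_)
  exact tendsto_inner_mulOp_translationL
    ((hasCompactSupport_plateau n).is_zero_at_infty.mono_left atTop_le_cocompact) η ξ

theorem tendsto_translationL_conj_apply {T A : L2R →L[ℂ] L2R} {f : ℝ →ᵇ ℂ}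
    (hf : Tendsto f atTop (𝓝 1)) (hA : ∀ t, A * translationL t = translationL t * A)
    (hT : IsCompactOperator (T - mulOp f * A)) (ξ : L2R) :
    Tendsto (fun t => (translationL (-t) * T * translationL t) ξ) atTop (𝓝 (A ξ)) := by
  have tendsto_mulOp : Tendsto (fun t => (translationL (-t) * (mulOp f * A) * translationL t) ξ)
      atTop (𝓝 (A ξ)) := by
    have h := tendsto_mulOp_addRight hf (A ξ)
    rw [one_smul] at h
    refine h.congr fun t => ?_
    rw [mul_assoc, mul_assoc, hA, ← mul_assoc (mulOp f), mulOp_mul_translationL, ← mul_assoc,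
      ← mul_assoc, translationL_neg_mul, one_mul, mul_apply_eq_comp]
  have tendsto_compact : Tendsto (fun t => (translationL (-t) * (T - mulOp f * A) *
      translationL t) ξ) atTop (𝓝 0) := by
    have h := tendsto_zero_of_isCompactOperator hT (fun t => (norm_translationL_apply t ξ).le)
      (tendsto_inner_translationL · ξ)
    refine squeeze_zero_norm (fun t => ?_) (tendsto_zero_iff_norm_tendsto_zero.mp h)
    rw [mul_assoc, mul_apply_eq_comp, norm_translationL_apply, mul_apply_eq_comp]
  have h := tendsto_compact.add tendsto_mulOp
  rw [zero_add] at h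
  refine h.congr fun t => ?_
  rw [← add_apply, ← add_mul, ← mul_add, sub_add_cancel]

theorem norm_le_of_isCompactOperator_sub {T A : L2R →L[ℂ] L2R} {f : ℝ →ᵇ ℂ}
    (hf : Tendsto f atTop (𝓝 1)) (hA : ∀ t, A * translationL t = translationL t * A)
    (hT : IsCompactOperator (T - mulOp f * A)) : ‖A‖ ≤ ‖T‖ := by
  refine A.opNorm_le_bound (norm_nonneg T) fun ξ =>
    le_of_tendsto (tendsto_translationL_conj_apply hf hA hT ξ).norm (.of_forall fun t => ?_)
  rw [mul_assoc, mul_apply_eq_comp, norm_translationL_apply, mul_apply_eq_comp]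
  exact (T.le_opNorm _).trans_eq (by rw [norm_translationL_apply])

theorem eq_zero_of_isCompactOperator_mulOp_mul {A : L2R →L[ℂ] L2R} {f : ℝ →ᵇ ℂ}
    (hf : Tendsto f atTop (𝓝 1)) (hA : ∀ t, A * translationL t = translationL t * A)
    (hfA : IsCompactOperator (mulOp f * A)) : A = 0 := by
  have h := norm_le_of_isCompactOperator_sub (T := 0) hf hA (by rw [zero_sub]; exact hfA.neg)
  rwa [norm_zero, norm_le_zero_iff] at h

/-- The operators that agree, up to a compact operator, with `M(ramp) G` for some `G ∈ λ(C*(ℝ))`.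
The operator `G` is the symbol at `+∞`. -/
def asymptoticConv : NonUnitalStarSubalgebra ℂ (L2R →L[ℂ] L2R) where
  carrier := {T | ∃ G ∈ groupCStar, IsCompactOperator (T - mulOp ramp * G)}
  zero_mem' := ⟨0, zero_mem _, by
    rw [mul_zero, sub_zero]
    exact isCompactOperator_zero⟩
  add_mem' := by
    rintro S T ⟨G, hG, hS⟩ ⟨H, hH, hT⟩
    refine ⟨G + H, add_mem hG hH, ?_⟩
    rw [mul_add, add_sub_add_comm]
    exact hS.add hT
  smul_mem' := by
    rintro c T ⟨G, hG, hT⟩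
    refine ⟨c • G, SMulMemClass.smul_mem c hG, ?_⟩
    rw [mul_smul_comm, ← smul_sub]
    exact hT.smul c
  mul_mem' := by
    rintro S T ⟨G, hG, hS⟩ ⟨H, hH, hT⟩
    refine ⟨G * H, mul_mem hG hH, ?_⟩
    have decomposition : S * T - mulOp ramp * (G * H) =
        (S - mulOp ramp * G) * T + mulOp ramp * G * (T - mulOp ramp * H) -
          mulOp ramp * ⁅mulOp ramp, G⁆ * H + mulOp ramp * (mulOp ramp - 1) * G * H := by
      rw [Ring.lie_def]
      noncomm_ring
    rw [decomposition]
    exact (((hS.comp_clm T).add (hT.clm_comp (mulOp ramp * G))).sub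
      (((isCompactOperator_lie_ramp hG).clm_comp (mulOp ramp)).comp_clm H)).add
      ((isCompactOperator_ramp_mul_ramp_sub_one_mul hG).comp_clm H)
  star_mem' := by
    rintro T ⟨G, hG, hT⟩
    refine ⟨star G, star_mem hG, ?_⟩
    have decomposition : star T - mulOp ramp * star G =
        star (T - mulOp ramp * G) - ⁅mulOp ramp, star G⁆ := by
      rw [star_sub, star_mul, star_mulOp_ramp, Ring.lie_def]
      noncomm_ring
    rw [decomposition]
    exact (isCompactOperator_adjoint hT).sub (isCompactOperator_lie_ramp (star_mem hG))

theorem mem_asymptoticConv {T : L2R →L[ℂ] L2R} :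
    T ∈ asymptoticConv ↔ ∃ G ∈ groupCStar, IsCompactOperator (T - mulOp ramp * G) :=
  Iff.rfl

theorem isClosed_asymptoticConv : IsClosed (asymptoticConv : Set (L2R →L[ℂ] L2R)) := by
  refine isClosed_of_closure_subset fun T hT => ?_
  obtain ⟨S, hS, hST⟩ := mem_closure_iff_seq_limit.mp hT
  choose G hG hSG using fun n => mem_asymptoticConv.mp (hS n)
  have dist_le (m n : ℕ) : dist (G m) (G n) ≤ dist (S m) (S n) := by
    rw [dist_eq_norm, dist_eq_norm]
    refine norm_le_of_isCompactOperator_sub tendsto_ramp_atTop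
      (mul_translationL_comm (sub_mem (hG m) (hG n))) ?_
    rw [mul_sub, sub_sub_sub_comm]
    exact (hSG m).sub (hSG n)
  have cauchy : CauchySeq G := Metric.cauchySeq_iff.mpr fun ε hε =>
    (Metric.cauchySeq_iff.mp hST.cauchySeq ε hε).imp fun N hN m hm n hn =>
      (dist_le m n).trans_lt (hN m hm n hn)
  obtain ⟨H, hGH⟩ := cauchySeq_tendsto_of_complete cauchy
  exact ⟨H, (NonUnitalStarSubalgebra.isClosed_topologicalClosure _).mem_of_tendsto hGH
    (.of_forall hG), isClosed_setOfPred_isCompactOperator.mem_of_tendsto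
      (hST.sub (hGH.const_mul (mulOp ramp))) (.of_forall hSG)⟩

theorem cocompact_compl_singleton {X : Type*} [TopologicalSpace X] [CompactSpace X] [T2Space X]
    (p : X) : cocompact ({p}ᶜ : Set X) = comap (↑) (𝓝 p) := by
  refine le_antisymm (fun s hs => ?_) (fun s hs => ?_)
  · obtain ⟨U, hU, hUs⟩ := mem_comap.mp hs
    obtain ⟨V, hVU, hV, hpV⟩ := mem_nhds_iff.mp hU
    have isCompact : IsCompact ((↑) ⁻¹' Vᶜ : Set ({p}ᶜ : Set X)) := by
      rw [Subtype.isCompact_iff, Subtype.image_preimage_coe, Set.inter_eq_right.mpr]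
      · exact hV.isClosed_compl.isCompact
      · exact Set.compl_subset_compl.mpr (Set.singleton_subset_iff.mpr hpV)
    exact mem_of_superset isCompact.compl_mem_cocompact fun x hx => hUs (hVU (not_not.mp hx))
  · obtain ⟨K, hK, hKs⟩ := mem_cocompact.mp hs
    refine mem_comap.mpr ⟨((↑) '' K)ᶜ, ?_, fun x hx => hKs fun hxK => hx ⟨x, hxK, rfl⟩⟩
    refine (Subtype.isCompact_iff.mp hK).isClosed.isOpen_compl.mem_nhds ?_
    rintro ⟨x, -, hx⟩
    exact x.2 hx

theorem cocompact_extLine : cocompact ExtLine = comap (↑) (𝓝 (⊥ : EReal)) := by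
  unfold ExtLine
  rw [Set.Ioi_bot]
  exact cocompact_compl_singleton ⊥

/-- The point `+∞` of `(-∞, +∞]`. -/
def extLineTop : ExtLine :=
  ⟨⊤, Set.mem_Ioi.mpr bot_lt_top⟩

theorem tendsto_comp_toExtLine_atTop (f : C₀(ExtLine, ℂ)) :
    Tendsto (fun x => f (toExtLine x)) atTop (𝓝 (f extLineTop)) := by
  refine ((map_continuous f).tendsto _).comp (tendsto_subtype_rng.mpr ?_)
  exact (EReal.tendsto_coe_nhds_top_iff (f := id)).mpr tendsto_id

theorem tendsto_comp_toExtLine_atBot (f : C₀(ExtLine, ℂ)) :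
    Tendsto (fun x => f (toExtLine x)) atBot (𝓝 0) := by
  refine f.zero_at_infty'.comp ?_
  rw [cocompact_extLine, tendsto_comap_iff]
  exact (EReal.tendsto_coe_nhds_bot_iff (f := id)).mpr tendsto_id

theorem continuous_eReal_rec {E : Type*} [TopologicalSpace E] {φ : ℝ → E} (hφ : Continuous φ)
    {a b : E} (ha : Tendsto φ atBot (𝓝 a)) (hb : Tendsto φ atTop (𝓝 b)) :
    Continuous (EReal.rec a φ b : EReal → E) := by
  refine continuous_iff_continuousAt.mpr fun x => ?_
  induction x with
  | bot => exact continuousAt_iff_punctured_nhds.mpr (by rwa [EReal.nhdsWithin_bot])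
  | coe x =>
    rw [ContinuousAt, EReal.nhds_coe]
    exact hφ.tendsto x
  | top => exact continuousAt_iff_punctured_nhds.mpr (by rwa [EReal.nhdsWithin_top])

theorem exists_comp_toExtLine_eq {φ : ℝ → ℂ} (hφ : Continuous φ) {c : ℂ}
    (hbot : Tendsto φ atBot (𝓝 0)) (htop : Tendsto φ atTop (𝓝 c)) :
    ∃ f : C₀(ExtLine, ℂ), ∀ x, f (toExtLine x) = φ x := by
  have continuous_rec := continuous_eReal_rec hφ hbot htop
  refine ⟨⟨⟨_, continuous_rec.comp continuous_subtype_val⟩, ?_⟩, fun x => rfl⟩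
  rw [cocompact_extLine]
  exact (continuous_rec.tendsto ⊥).comp tendsto_comap

theorem mulOp_mul_mem_wienerHopf {φ : ℝ →ᵇ ℂ} {c : ℂ} (hbot : Tendsto φ atBot (𝓝 0))
    (htop : Tendsto φ atTop (𝓝 c)) {G : L2R →L[ℂ] L2R} (hG : G ∈ groupCStar) :
    mulOp φ * G ∈ wienerHopf := by
  obtain ⟨f, hf⟩ := exists_comp_toExtLine_eq φ.continuous hbot htop
  refine NonUnitalStarSubalgebra.le_topologicalClosure _
    (NonUnitalStarAlgebra.subset_adjoin ℂ _ ⟨f, G, hG, ?_⟩)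
  rw [mulRep_eq_mulOp]
  congr 2
  ext x
  exact (hf x).symm

theorem isClosed_wienerHopf : IsClosed (wienerHopf : Set (L2R →L[ℂ] L2R)) :=
  NonUnitalStarSubalgebra.isClosed_topologicalClosure _

theorem wienerHopf_le_asymptoticConv : wienerHopf ≤ asymptoticConv := by
  refine NonUnitalStarSubalgebra.topologicalClosure_minimal _
    (NonUnitalStarAlgebra.adjoin_le ?_) isClosed_asymptoticConv
  rintro _ ⟨f, G, hG, rfl⟩
  refine ⟨f extLineTop • G, SMulMemClass.smul_mem _ hG, ?_⟩
  rw [mulRep_eq_mulOp, mul_smul_comm, ← smul_mul_assoc, ← map_smul, ← sub_mul, ← map_sub]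
  refine isCompactOperator_mulOp_mul ?_ hG
  rw [cocompact_eq_atBot_atTop, tendsto_sup]
  constructor
  · have h := (tendsto_comp_toExtLine_atBot f).sub (tendsto_ramp_atBot.const_mul (f extLineTop))
    rwa [mul_zero, sub_zero] at h
  · have h := (tendsto_comp_toExtLine_atTop f).sub (tendsto_ramp_atTop.const_mul (f extLineTop))
    rwa [mul_one, sub_self] at h

theorem mulOp_mul_mem_wienerHopf_of_hasCompactSupport {φ : ℝ →ᵇ ℂ} (hφ : HasCompactSupport φ)
    {G : L2R →L[ℂ] L2R} (hG : G ∈ groupCStar) : mulOp φ * G ∈ wienerHopf :=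
  mulOp_mul_mem_wienerHopf (hφ.is_zero_at_infty.mono_left atBot_le_cocompact)
    (hφ.is_zero_at_infty.mono_left atTop_le_cocompact) hG

theorem hasCompactSupport_star {φ : ℝ →ᵇ ℂ} (hφ : HasCompactSupport φ) :
    HasCompactSupport (star φ : ℝ →ᵇ ℂ) := by
  rw [BoundedContinuousFunction.coe_star]
  exact HasCompactSupport.comp_left hφ (g := (star : ℂ → ℂ)) (star_zero ℂ)

theorem mul_mulOp_mem_wienerHopf_of_hasCompactSupport {φ : ℝ →ᵇ ℂ} (hφ : HasCompactSupport φ)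
    {G : L2R →L[ℂ] L2R} (hG : G ∈ groupCStar) : G * mulOp φ ∈ wienerHopf := by
  have star_mem_wienerHopf : star (mulOp (star φ) * star G) ∈ wienerHopf :=
    star_mem (mulOp_mul_mem_wienerHopf_of_hasCompactSupport
      (hasCompactSupport_star hφ) (star_mem hG))
  rwa [star_mul, star_star, map_star, star_star] at star_mem_wienerHopf

theorem convRep_toL1_mul_translationL {g : ℝ → ℂ} (hg : Integrable g) (t : ℝ) :
    convRep (hg.toL1 g) * translationL t = convRep ((hg.comp_sub_right t).toL1) := by
  rw [mul_translationL_comm (convRep_mem_groupCStar _), translationL_mul_convRep]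
  congr 1
  refine (DomAddAct.mk_vadd_toLp (-t) (memLp_one_iff_integrable.mpr hg)).trans ?_
  congr 1
  ext x
  rw [vadd_eq_add, neg_add_eq_sub]

theorem mulOp_mul_convRep_mul_convRep_mul_mulOp_eq_rankOne {φ θ : ℝ →ᵇ ℂ} {g h a b : ℝ → ℂ}
    (hg : Integrable g) (hh : Integrable h) (integral_h : ∫ t, h t = 1) (ha : MemLp a 2)
    (hb : MemLp b 2)
    (kernel : ∀ t, h t ≠ 0 → ∀ x y, φ x * g (x - y - t) * θ y = a x * conj (b y)) :
    mulOp φ * convRep (hg.toL1 g) * (convRep (hh.toL1 h) * mulOp θ) =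
      InnerProductSpace.rankOne ℂ (ha.toLp a) (hb.toLp b) := by
  ext1 ξ
  rw [← mul_assoc, mul_convRep_mul_apply,
    ← one_smul ℂ (InnerProductSpace.rankOne ℂ (ha.toLp a) (hb.toLp b) ξ), ← integral_h,
    ← integral_smul_const]
  refine integral_congr_ae ?_
  filter_upwards [hh.coeFn_toL1] with t ht
  rw [ht]
  by_cases h_zero : h t = 0
  · rw [h_zero, zero_smul, zero_smul]
  · rw [mul_assoc (mulOp φ), convRep_toL1_mul_translationL,
      mulOp_mul_convRep_mul_mulOp_eq_rankOne (hg.comp_sub_right t) ha hb (kernel t h_zero)]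

/-- The class in `L²(ℝ)` of a compactly supported continuous function. -/
def toL2 (φ : ℝ →ᵇ ℂ) (hφ : HasCompactSupport φ) : L2R :=
  (φ.continuous.memLp_of_hasCompactSupport hφ).toLp

theorem exists_mulOp_mul_convRep_mul_convRep_mul_mulOp_eq_rankOne {φ θ : ℝ →ᵇ ℂ}
    (hφ : HasCompactSupport φ) (hθ : HasCompactSupport θ) :
    ∃ g h, mulOp φ * convRep g * (convRep h * mulOp (star θ)) =
      InnerProductSpace.rankOne ℂ (toL2 φ hφ) (toL2 θ hθ) := by
  obtain ⟨a, -, ha⟩ := hφ.exists_pos_le_norm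
  obtain ⟨b, -, hb⟩ := hθ.exists_pos_le_norm
  have integrable_plateau := (plateau (a + b + 1)).continuous.integrable_of_hasCompactSupport
    (μ := volume) (hasCompactSupport_plateau _)
  have integrable_indicator : Integrable ((Set.Icc (0 : ℝ) 1).indicator fun _ => (1 : ℂ)) :=
    (integrable_indicator_iff measurableSet_Icc).mpr
      (integrableOn_const isCompact_Icc.measure_lt_top.ne)
  have integral_one : ∫ t, (Set.Icc (0 : ℝ) 1).indicator (fun _ => (1 : ℂ)) t = 1 := by
    simp [integral_indicator measurableSet_Icc]
  refine ⟨_, _, mulOp_mul_convRep_mul_convRep_mul_mulOp_eq_rankOne integrable_plateau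
    integrable_indicator integral_one _ _ fun t ht x y => ?_⟩
  rw [BoundedContinuousFunction.star_apply]
  rcases le_or_gt a ‖x‖ with hx | hx
  · rw [ha x hx, zero_mul, zero_mul, zero_mul]
  rcases le_or_gt b ‖y‖ with hy | hy
  · rw [hb y hy, star_zero, mul_zero, map_zero, mul_zero]
  have t_mem := Set.mem_of_indicator_ne_zero ht
  rw [Real.norm_eq_abs, abs_lt] at hx hy
  rw [plateau_of_abs_le, mul_one]
  · rfl
  · rw [abs_le]
    constructor <;> linarith [t_mem.1, t_mem.2]

theorem rankOne_toL2_mem_wienerHopf {φ θ : ℝ →ᵇ ℂ} (hφ : HasCompactSupport φ)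
    (hθ : HasCompactSupport θ) :
    InnerProductSpace.rankOne ℂ (toL2 φ hφ) (toL2 θ hθ) ∈ wienerHopf := by
  obtain ⟨g, h, hgh⟩ := exists_mulOp_mul_convRep_mul_convRep_mul_mulOp_eq_rankOne hφ hθ
  rw [← hgh]
  exact mul_mem (mulOp_mul_mem_wienerHopf_of_hasCompactSupport hφ (convRep_mem_groupCStar g))
    (mul_mulOp_mem_wienerHopf_of_hasCompactSupport (hasCompactSupport_star hθ)
      (convRep_mem_groupCStar h))

theorem dense_toL2 : Dense {ξ | ∃ φ hφ, toL2 φ hφ = ξ} := by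
  refine (Lp.dense_hasCompactSupport_contDiff (by simp)).mono ?_
  rintro ξ ⟨φ, hξ, hφ, smooth⟩
  obtain ⟨C, hC⟩ := hφ.exists_bound_of_continuous smooth.continuous
  exact ⟨.ofNormedAddCommGroup φ smooth.continuous C hC, hφ,
    Lp.ext ((MemLp.coeFn_toLp _).trans hξ.symm)⟩

theorem rankOne_mem_wienerHopf (ξ η : L2R) : InnerProductSpace.rankOne ℂ ξ η ∈ wienerHopf := by
  refine dense_toL2.induction (P := fun ξ => InnerProductSpace.rankOne ℂ ξ η ∈ wienerHopf) ?_
    (isClosed_wienerHopf.preimage (f := fun ξ => InnerProductSpace.rankOne ℂ ξ η) (by fun_prop)) ξ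
  rintro _ ⟨φ, hφ, rfl⟩
  refine dense_toL2.induction
    (P := fun η => InnerProductSpace.rankOne ℂ (toL2 φ hφ) η ∈ wienerHopf) ?_
    (isClosed_wienerHopf.preimage (f := fun η => InnerProductSpace.rankOne ℂ (toL2 φ hφ) η)
      (by fun_prop)) η
  rintro _ ⟨θ, hθ, rfl⟩
  exact rankOne_toL2_mem_wienerHopf hφ hθ

theorem mem_wienerHopf_of_isCompactOperator {T : L2R →L[ℂ] L2R} (hT : IsCompactOperator T) :
    T ∈ wienerHopf :=
  compactOperator_induction (p := fun T => T ∈ wienerHopf) rankOne_mem_wienerHopf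
    (fun _ _ => add_mem) isClosed_wienerHopf hT

theorem exists_convRep_ne_zero : ∃ g, convRep g ≠ 0 := by
  have hφ := hasCompactSupport_plateau 0
  obtain ⟨g, h, hgh⟩ := exists_mulOp_mul_convRep_mul_convRep_mul_mulOp_eq_rankOne hφ hφ
  refine ⟨g, fun hg => ?_⟩
  rw [hg, mul_zero, zero_mul, eq_comm, InnerProductSpace.rankOne_eq_zero, or_self] at hgh
  have ae_zero : plateau 0 =ᵐ[volume] (0 : ℝ → ℂ) :=
    (MemLp.coeFn_toLp _).symm.trans (Lp.eq_zero_iff_ae_eq_zero.mp hgh)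
  have eq_zero := (plateau 0).continuous.ae_eq_iff_eq volume continuous_zero |>.mp ae_zero
  exact one_ne_zero ((plateau_of_abs_le abs_zero.le).symm.trans (congrFun eq_zero 0))

theorem exists_mem_wienerHopf_not_isCompactOperator :
    ∃ T ∈ wienerHopf, ¬ IsCompactOperator T := by
  obtain ⟨g, hg⟩ := exists_convRep_ne_zero
  have mem := convRep_mem_groupCStar g
  exact ⟨mulOp ramp * convRep g, mulOp_mul_mem_wienerHopf tendsto_ramp_atBot tendsto_ramp_atTop mem,
    fun h => hg (eq_zero_of_isCompactOperator_mulOp_mul tendsto_ramp_atTop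
      (mul_translationL_comm mem) h)⟩

theorem conjStarAlgEquiv_mulOp (u : DiffeoR) (hu : OrientationPreserving u) (f : ℝ →ᵇ ℂ) :
    (diffeoUnitary u hu).conjStarAlgEquiv
      (mulOp (f.compContinuous ⟨u.symm, u.symm.continuous⟩)) = mulOp f := by
  ext1 ξ
  obtain ⟨η, rfl⟩ := (diffeoUnitary u hu).surjective ξ
  rw [LinearIsometryEquiv.conjStarAlgEquiv_apply_apply, LinearIsometryEquiv.symm_apply_apply]
  refine Lp.ext ?_
  filter_upwards [diffeoUnitary_coeFn u hu (mulOp (f.compContinuous ⟨u.symm, _⟩) η),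
    (quasiMeasurePreserving hu).ae (mulOp_coeFn (f.compContinuous ⟨u.symm, _⟩) η),
    mulOp_coeFn f (diffeoUnitary u hu η), diffeoUnitary_coeFn u hu η] with x hUf hf hfU hU
  rw [hUf, hf, hfU, hU, BoundedContinuousFunction.compContinuous_apply, ContinuousMap.coe_mk,
    u.symm_apply_apply, mul_left_comm]

theorem isCompactOperator_lie_of_mem_wienerHopf {ψ : ℝ →ᵇ ℂ} (hψ : SlowlyVarying ψ)
    {S : L2R →L[ℂ] L2R} (hS : S ∈ wienerHopf) :
    IsCompactOperator (⁅mulOp ψ, S⁆ : L2R →L[ℂ] L2R) := by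
  obtain ⟨H, hH, hSH⟩ := wienerHopf_le_asymptoticConv hS
  have commute : mulOp ψ * mulOp ramp = mulOp ramp * mulOp ψ := by
    rw [← map_mul, mul_comm, map_mul]
  have decomposition : ⁅mulOp ψ, S⁆ = mulOp ψ * (S - mulOp ramp * H) -
      (S - mulOp ramp * H) * mulOp ψ + mulOp ramp * ⁅mulOp ψ, H⁆ := by
    rw [Ring.lie_def, Ring.lie_def, mul_sub, ← mul_assoc, commute]
    noncomm_ring
  rw [decomposition]
  exact ((hSH.clm_comp (mulOp ψ)).sub (hSH.comp_clm (mulOp ψ))).add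
    (isCompactOperator_ramp_mul_lie hψ hH)

theorem mulOp_character_conj_eq_self {T G : L2R →L[ℂ] L2R} (hG : G ∈ groupCStar)
    (hTG : IsCompactOperator (T - mulOp ramp * G)) {s : ℝ}
    (hT : IsCompactOperator (⁅mulOp (character s), T⁆ : L2R →L[ℂ] L2R)) :
    mulOp (character s) * G * mulOp (character (-s)) = G := by
  refine sub_eq_zero.mp (eq_zero_of_isCompactOperator_mulOp_mul tendsto_ramp_atTop
    (mul_translationL_comm (sub_mem (mulOp_character_conj_mem_groupCStar s hG) hG)) ?_)
  have cancel : T * mulOp (character s) * mulOp (character (-s)) = T := by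
    rw [mul_assoc, ← map_mul, character_mul_neg, map_one, mul_one]
  have commute : mulOp ramp * mulOp (character s) = mulOp (character s) * mulOp ramp := by
    rw [← map_mul, mul_comm, map_mul]
  have decomposition : mulOp ramp *
      (mulOp (character s) * G * mulOp (character (-s)) - G) =
      ⁅mulOp (character s), T⁆ * mulOp (character (-s)) + (T - mulOp ramp * G) -
        mulOp (character s) * (T - mulOp ramp * G) * mulOp (character (-s)) := by
    rw [Ring.lie_def, sub_mul _ _ (mulOp (character (-s))), cancel, mul_sub, ← mul_assoc,
      ← mul_assoc, commute]
    noncomm_ring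
  rw [decomposition]
  exact ((hT.comp_clm (mulOp (character (-s)))).add hTG).sub
    ((hTG.clm_comp (mulOp (character s))).comp_clm (mulOp (character (-s))))

theorem isCompactOperator_of_isCompactOperator_lie_character {T : L2R →L[ℂ] L2R}
    (hT : T ∈ wienerHopf)
    (h : ∀ s, IsCompactOperator (⁅mulOp (character s), T⁆ : L2R →L[ℂ] L2R)) :
    IsCompactOperator T := by
  obtain ⟨G, hG, hTG⟩ := wienerHopf_le_asymptoticConv hT
  have symbol_eq_zero : G = 0 := by
    ext1 ξ
    refine tendsto_nhds_unique (f := fun _ : ℝ => G ξ) tendsto_const_nhds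
      ((tendsto_mulOp_character_conj_apply hG ξ).congr fun s => ?_)
    rw [mulOp_character_conj_eq_self hG hTG (h s)]
  rwa [symbol_eq_zero, mul_zero, sub_zero] at hTG

theorem isCompactOperator_of_mem_wienerHopf_of_mem_adImage {u : DiffeoR}
    (hu : OrientationPreserving u) (hlim : Tendsto (deriv u) atTop atTop) {T : L2R →L[ℂ] L2R}
    (hT : T ∈ wienerHopf) (hT' : T ∈ adImage (diffeoUnitary u hu) wienerHopf) :
    IsCompactOperator T := by
  refine isCompactOperator_of_isCompactOperator_lie_character hT fun s => ?_
  obtain ⟨S, hS, rfl⟩ := hT'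
  have h := (isCompactOperator_conjStarAlgEquiv_iff (e := diffeoUnitary u hu)).mpr
    (isCompactOperator_lie_of_mem_wienerHopf
      (ψ := (character s).compContinuous ⟨u.symm, u.symm.continuous⟩)
      (slowlyVarying_character_comp_symm hu hlim s) hS)
  rwa [Ring.lie_def, map_sub, map_mul, map_mul, conjStarAlgEquiv_mulOp] at h

theorem mem_adImage_of_isCompactOperator (U : L2R ≃ₗᵢ[ℂ] L2R) {T : L2R →L[ℂ] L2R}
    (hT : IsCompactOperator T) : T ∈ adImage U wienerHopf :=
  ⟨U.symm.conjStarAlgEquiv T,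
    mem_wienerHopf_of_isCompactOperator (isCompactOperator_conjStarAlgEquiv_iff.mpr hT),
    U.conjStarAlgEquiv.apply_symm_apply T⟩

end WienerHopf

end

theorem mainTheorem8 (u : WienerHopf.DiffeoR) (hu : WienerHopf.OrientationPreserving u)
    (hlim : Filter.Tendsto (deriv u) Filter.atTop Filter.atTop) :
    ¬ WienerHopf.adImage (WienerHopf.diffeoUnitary u hu) WienerHopf.wienerHopf
        ≤ WienerHopf.wienerHopf ∧
    ((WienerHopf.wienerHopf ⊓
        WienerHopf.adImage (WienerHopf.diffeoUnitary u hu) WienerHopf.wienerHopf :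
      NonUnitalStarSubalgebra ℂ (WienerHopf.L2R →L[ℂ] WienerHopf.L2R)) :
        Set (WienerHopf.L2R →L[ℂ] WienerHopf.L2R)) =
      {T : WienerHopf.L2R →L[ℂ] WienerHopf.L2R | IsCompactOperator T} := by
  refine ⟨fun hle => ?_, Set.Subset.antisymm ?_ ?_⟩
  · obtain ⟨S, hS, not_compact⟩ := WienerHopf.exists_mem_wienerHopf_not_isCompactOperator
    have hUS : (WienerHopf.diffeoUnitary u hu).conjStarAlgEquiv S ∈
        WienerHopf.adImage (WienerHopf.diffeoUnitary u hu) WienerHopf.wienerHopf := ⟨S, hS, rfl⟩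
    exact not_compact (WienerHopf.isCompactOperator_conjStarAlgEquiv_iff.mp
      (WienerHopf.isCompactOperator_of_mem_wienerHopf_of_mem_adImage hu hlim (hle hUS) hUS))
  · rintro T ⟨hT, hT'⟩
    exact WienerHopf.isCompactOperator_of_mem_wienerHopf_of_mem_adImage hu hlim hT hT'
  · intro T hT
    exact ⟨WienerHopf.mem_wienerHopf_of_isCompactOperator hT,
      WienerHopf.mem_adImage_of_isCompactOperator _ hT⟩
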